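/- Fix a real $\alpha\ge 1$. There are a randomized algorithm and constants $c\in\mathbb N$, $K>0$ (depending only on $\alpha$) such that the following holds for all integers $p,q,r\ge 1$, every real $\varepsilon>0$ and all 0-1 matrices $A$ of size $p\times q$ and $B$ of size $q\times r$. Let $C=AB$ be their arithmetic product, let $N=pq+qr$ be the input size, and let $\mathrm{ham}(A_{i*},B_{*j})$ be the Hamming distance (the number of differing coordinates) between the $i$-th row of $A$ and the $j$-th column of $B$. Given $A$, $B$ and $\varepsilon$, the algorithm computes a $p\times r$ matrix $C''$ of non-negative integers such that, with probability at least $1-N^{-\alpha}$, simultaneously for all $1\le i\le p$ and $1\le j\le r$, $$|C''_{ij}-C_{ij}|\le \varepsilon\,\min\{\mathrm{ham}(A_{i*},B_{*j}),\ q-\mathrm{ham}(A_{i*},B_{*j})\},$$ and for all outcomes of its random choices its running time is at most $$K\cdot\frac{\log N}{\bar\varepsilon^{2}}\Bigl(N\log_{1+\bar\varepsilon}\bar q+pr\,\log\log_{1+\bar\varepsilon}\bar q\Bigr),\qquad \bar\varepsilon=\min\{\varepsilon,\tfrac12\},\quad \bar q=\max\{q,2\}.$$ In particular, for $\varepsilon\le\frac12$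 and $q\ge 2$ the running time is $O\bigl((\log N/\varepsilon^2)(N\log_{1+\varepsilon}q+pr\log\log_{1+\varepsilon}q)\bigr)$. The algorithm is one fixed program (for all $p,q,r,\varepsilon,A,B$), built by sequencing, two-way branching and counted loops, for a randomized word RAM with word length $c\lceil\log_2 N\rceil$ bits: addition, truncated subtraction, multiplication and integer division of words (sums and products modulo $2^{c\lceil\log_2 N\rceil}$), loading a constant, reading and writing a memory cell, drawing a uniformly random element of $\{0,\dots,v-1\}$ for a word $v$, comparing two words, testing $\varepsilon x\le y$ for words $x,y$ (the only access to the real number $\varepsilon$), and entering a loop or one of its iterations cost one unit of time each. Initially $p,q,r$ are in registers and the entries of $A$ and $B$ are in memory, row by row. -/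

import Mathlib

/-!
A randomized word RAM, given as a small imperative language with a step count.

* A machine has numbered registers and a memory addressed by words. All results of arithmetic are
  reduced modulo `2 ^ w`, where `w` is the word length.
* Every basic instruction, every test and every loop iteration costs one unit of time.
* A program is a fixed finite piece of syntax. It uses finitely many registers, and it does
  not depend on the input.
* A real parameter `ε` is available to a program only through the comparisons `ε * x ≤ y`
  with words `x` and `y`.
-/

namespace WordRAM

/-- A state: the registers, the memory, and the number of steps made so far
(programs cannot read this last component). -/
structure State where
  reg : ℕ → ℕ
  mem : ℕ → ℕ
  time : ℕ

/-- One unit of time passes. -/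
def State.tick (s : State) : State := { s with time := s.time + 1 }

/-- Write `v` to register `x`. -/
def State.setReg (s : State) (x v : ℕ) : State := { s with reg := Function.update s.reg x v }

/-- Write `v` to the memory cell with address `a`. -/
def State.setMem (s : State) (a v : ℕ) : State := { s with mem := Function.update s.mem a v }

/-- Binary operations on words. -/
inductive Op where
  | add | sub | mul | div

/-- Sums and products are taken modulo `2 ^ w`, differences are truncated at `0`, quotients are
rounded down (and division by `0` gives `0`). -/
def Op.eval (w : ℕ) : Op → ℕ → ℕ → ℕ
  | .add, a, b => (a + b) % 2 ^ w
  | .sub, a, b => a - b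
  | .mul, a, b => (a * b) % 2 ^ w
  | .div, a, b => a / b

/-- Programs. The numbers `x`, `y`, `z` are names of registers. -/
inductive Prog where
  /-- do nothing -/
  | skip
  /-- `x := n` for a constant `n` -/
  | const (x n : ℕ)
  /-- `x := y op z` -/
  | arith (o : Op) (x y z : ℕ)
  /-- `x := mem[y]` -/
  | load (x y : ℕ)
  /-- `mem[x] := y` -/
  | store (x y : ℕ)
  /-- `x :=` a uniformly random element of `{0, …, y - 1}`, independent of all earlier ones -/
  | rand (x y : ℕ)
  /-- first `c`, then `d` -/
  | seq (c d : Prog)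
  /-- if `x < y` then `c` else `d` -/
  | ifLt (x y : ℕ) (c d : Prog)
  /-- if `ε * x ≤ y` then `c` else `d` -/
  | ifEps (x y : ℕ) (c d : Prog)
  /-- execute `c` as many times as the value of `x` on entry says -/
  | loop (x : ℕ) (c : Prog)

/-- The uniform distribution on `{0, …, v - 1}` (on `{0}` if `v = 0`). -/
noncomputable def uniformBelow (v : ℕ) : PMF ℕ :=
  (PMF.uniformOfFintype (Fin (v - 1 + 1))).map fun i => (i : ℕ)

/-- Repeat a randomized transformation `n` times; each repetition costs one extra step. -/
noncomputable def iter (f : State → PMF State) : ℕ → State → PMF State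
  | 0, s => PMF.pure s
  | n + 1, s => (f s.tick).bind (iter f n)

/-- The distribution of the final state of a program started in the state `s`, on a machine with
word length `w` and real parameter `ε`. -/
noncomputable def Prog.run (w : ℕ) (ε : ℝ) : Prog → State → PMF State
  | .skip, s => PMF.pure s.tick
  | .const x n, s => PMF.pure (s.tick.setReg x (n % 2 ^ w))
  | .arith o x y z, s => PMF.pure (s.tick.setReg x (o.eval w (s.reg y) (s.reg z)))
  | .load x y, s => PMF.pure (s.tick.setReg x (s.mem (s.reg y)))
  | .store x y, s => PMF.pure (s.tick.setMem (s.reg x) (s.reg y))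
  | .rand x y, s => (uniformBelow (s.reg y)).map fun v => s.tick.setReg x v
  | .seq c d, s => (c.run w ε s).bind (d.run w ε)
  | .ifLt x y c d, s => if s.reg x < s.reg y then c.run w ε s.tick else d.run w ε s.tick
  | .ifEps x y c d, s =>
      open Classical in
      if ε * (s.reg x : ℝ) ≤ (s.reg y : ℝ) then c.run w ε s.tick else d.run w ε s.tick
  | .loop x c, s => iter (c.run w ε) (s.reg x) s.tick

/-- The start state for a pair of matrices: registers `0, 1, 2` hold `p, q, r`; the memory cells
`0, …, pq - 1` hold `A` row by row, the next `qr` cells hold `B` row by row; everything else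
is `0`. (`finProdFinEquiv (i, j) = j + n * i` for `n` columns.) -/
def matrixInput {p q r : ℕ} (A : Matrix (Fin p) (Fin q) ℕ) (B : Matrix (Fin q) (Fin r) ℕ) :
    State where
  reg x := if x = 0 then p else if x = 1 then q else if x = 2 then r else 0
  mem a :=
    if h : a < p * q then
      A (finProdFinEquiv.symm ⟨a, h⟩).1 (finProdFinEquiv.symm ⟨a, h⟩).2
    else if h' : a - p * q < q * r then
      B (finProdFinEquiv.symm ⟨a - p * q, h'⟩).1 (finProdFinEquiv.symm ⟨a - p * q, h'⟩).2
    else 0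
  time := 0

/-- The `p × r` matrix stored row by row directly behind the `pq + qr` input cells. -/
def matrixOutput (p q r : ℕ) (s : State) : Matrix (Fin p) (Fin r) ℕ :=
  fun i j => s.mem (p * q + q * r + (i * r + j))

end WordRAM

/-- `(log N / ε²) (N log_{1+ε} q + p r log log_{1+ε} q)` with `N = pq + qr`. -/
noncomputable def approxMatMulTime (p q r : ℕ) (ε : ℝ) : ℝ :=
  Real.log (p * q + q * r : ℕ) / ε ^ 2 *
    ((p * q + q * r : ℕ) * Real.logb (1 + ε) q + p * r * Real.log (Real.logb (1 + ε) q))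

/-!
The algorithm estimates all Hamming distances by random signs. For a uniformly random bit string `σ`
of length `q`, the difference of the Hamming distances of `σ` to a row `a` and to a column `b` is
`X = ∑ k, ± (a k - b k)` with independent random signs, so the mean of `X ^ 2` is `h = ham(a, b)`.
Likewise the sum of the two distances minus `q` is the corresponding signed sum for `a` and the
complement of `b`, and the mean of its square is `q - h`. One round costs `O(N + p r)` steps for all
pairs together: the distances of `σ` to all rows and columns are computed first. The squares are
accumulated over `T` rounds.

With `T = K m² L`, where `L` is about `log₂ N` and `m` is about `1 / ε`, all accumulators are within
a factor `1 ± 1 / (3 m)` of their means with probability at least `1 - N ^ (-α)`. This is a Chernoff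
bound (`expect_deviation_le`) together with a union bound (`expect_not_accurate_le`, `failure_le`).
The moment generating function of `X ^ 2` is bounded by induction on the number of signs that are
still to be drawn (`expect_exp_signedSum_le_aux`), where one step uses only `cosh x ≤ exp (x² / 2)`.

Since `2 C = ∑ a + ∑ b - h`, the smaller one of the two accumulators determines the entry `C` of the
product up to the error `min h (q - h) / m` after rounding (`abs_estimate_sub_le`). The program can
find `m` only up to the cap `q + 1`; if the cap is reached, then the error is below `1`, and so the
entry is exact (`abs_sub_le_of_le_div`). The resulting time `O((log N / ε²) (N + p r))` is within the
claimed bound, because `log_{1+ε} q` and its logarithm are bounded from below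
(`le_approxMatMulTime`).

The semantics of programs is handled by two notions. `Ensures` says that all outcomes have a property
and gives invariant rules for the deterministic parts. `Sim` compares the distribution of machine
states with the distribution of an abstract random process, the accumulators after some rounds;
probabilities are computed for the latter.
-/

open scoped ENNReal

namespace WordRAM

/-! ### Expectations, and reasoning about programs -/

/-- The expectation of a function with values in `[0, ∞]`. -/
noncomputable def expect {Ω : Type*} (μ : PMF Ω) (f : Ω → ℝ≥0∞) : ℝ≥0∞ := ∑' a, μ a * f a

section Expect

variable {Ω Ω' : Type*}

theorem expect_pure (a : Ω) (f : Ω → ℝ≥0∞) : expect (PMF.pure a) f = f a := by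
  classical
  unfold expect
  rw [tsum_eq_single a]
  · simp
  · intro b hb
    simp [PMF.pure_apply, hb]

theorem expect_bind (μ : PMF Ω) (k : Ω → PMF Ω') (f : Ω' → ℝ≥0∞) :
    expect (μ.bind k) f = expect μ fun a => expect (k a) f := by
  simp only [expect, PMF.bind_apply, ← ENNReal.tsum_mul_right, ← ENNReal.tsum_mul_left]
  rw [ENNReal.tsum_comm]
  simp only [mul_assoc]

theorem expect_map (μ : PMF Ω) (h : Ω → Ω') (f : Ω' → ℝ≥0∞) :
    expect (μ.map h) f = expect μ fun a => f (h a) := by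
  rw [← PMF.bind_pure_comp, expect_bind]
  simp [expect_pure]

theorem expect_mono_support {μ : PMF Ω} {f g : Ω → ℝ≥0∞} (h : ∀ a ∈ μ.support, f a ≤ g a) :
    expect μ f ≤ expect μ g := by
  refine ENNReal.tsum_le_tsum fun a => ?_
  by_cases ha : a ∈ μ.support
  · gcongr
    exact h a ha
  · simp [(PMF.apply_eq_zero_iff μ a).2 ha]

theorem expect_mono {μ : PMF Ω} {f g : Ω → ℝ≥0∞} (h : ∀ a, f a ≤ g a) :
    expect μ f ≤ expect μ g :=
  expect_mono_support fun a _ => h a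

theorem expect_const (μ : PMF Ω) (c : ℝ≥0∞) : expect μ (fun _ => c) = c := by
  simp [expect, ENNReal.tsum_mul_right, μ.tsum_coe]

theorem expect_const_mul (μ : PMF Ω) (c : ℝ≥0∞) (f : Ω → ℝ≥0∞) :
    expect μ (fun a => c * f a) = c * expect μ f := by
  simp only [expect, ← ENNReal.tsum_mul_left]
  congr 1
  ext a
  ring

theorem expect_add (μ : PMF Ω) (f g : Ω → ℝ≥0∞) :
    expect μ (fun a => f a + g a) = expect μ f + expect μ g := by
  simp only [expect, mul_add, ENNReal.tsum_add]

theorem expect_finset_sum {ι : Type*} (μ : PMF Ω) (t : Finset ι) (f : ι → Ω → ℝ≥0∞) :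
    expect μ (fun a => ∑ i ∈ t, f i a) = ∑ i ∈ t, expect μ (f i) := by
  classical
  induction t using Finset.induction_on with
  | empty => simp [expect]
  | insert i t hi ih => simp only [Finset.sum_insert hi, expect_add, ih]

theorem toOuterMeasure_eq_expect (μ : PMF Ω) (t : Set Ω) :
    μ.toOuterMeasure t = expect μ (t.indicator 1) := by
  rw [PMF.toOuterMeasure_apply]
  refine tsum_congr fun a => ?_
  by_cases ha : a ∈ t <;> simp [ha]

theorem expect_indicator_compl (μ : PMF Ω) (t : Set Ω) :
    expect μ (t.indicator 1) + expect μ (tᶜ.indicator 1) = 1 := by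
  rw [← expect_add, ← expect_const μ 1]
  congr 1
  ext a
  by_cases ha : a ∈ t <;> simp [ha]

/-- The definition of `uniformBelow` inserts a monadic coercion, which is removed here. -/
theorem uniformBelow_eq (v : ℕ) :
    uniformBelow v = PMF.map (fun i : Fin (v - 1 + 1) => (i : ℕ)) (PMF.uniformOfFintype _) := by
  unfold uniformBelow
  rw [show (fun i : ℕ => i) = id from rfl, PMF.map_id]
  rfl

theorem lt_of_mem_support_uniformBelow {v b : ℕ} (h : b ∈ (uniformBelow v).support) :
    b < v - 1 + 1 := by
  rw [uniformBelow_eq, PMF.mem_support_map_iff] at h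
  obtain ⟨i, -, rfl⟩ := h
  exact i.isLt

/-- The uniform distribution on two values averages. -/
theorem expect_uniformBelow_two (f : ℕ → ℝ≥0∞) :
    expect (uniformBelow 2) f = (f 0 + f 1) / 2 := by
  rw [uniformBelow_eq]
  change expect (PMF.map (fun i : Fin 2 => (i : ℕ)) (PMF.uniformOfFintype (Fin 2))) f = _
  rw [expect_map]
  simp only [expect, tsum_fintype, Fin.sum_univ_two, PMF.uniformOfFintype_apply]
  rw [← mul_add, mul_comm, Fintype.card_fin]
  rfl

end Expect

/-- Repeat a random transition `n` times. -/
noncomputable def iterM {Ω : Type*} (g : Ω → PMF Ω) : ℕ → Ω → PMF Ω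
  | 0, a => PMF.pure a
  | n + 1, a => (g a).bind (iterM g n)

/-- If one transition multiplies the expectation of `f` by at most `M`, then `n` transitions
multiply it by at most `M ^ n`. -/
theorem expect_iterM_le {Ω : Type*} {g : Ω → PMF Ω} {f : Ω → ℝ≥0∞} {M : ℝ≥0∞}
    (h : ∀ a, expect (g a) f ≤ M * f a) (n : ℕ) (a : Ω) :
    expect (iterM g n a) f ≤ M ^ n * f a := by
  induction n generalizing a with
  | zero => simp [iterM, expect_pure]
  | succ n ih =>
    rw [iterM, expect_bind]
    calc _ ≤ expect (g a) fun b => M ^ n * f b := expect_mono ih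
      _ = M ^ n * expect (g a) f := expect_const_mul _ _ _
      _ ≤ M ^ n * (M * f a) := by gcongr; exact h a
      _ = M ^ (n + 1) * f a := by ring

/-- All outcomes of `ρ` have the property `Q`. -/
def Ensures (ρ : PMF State) (Q : State → Prop) : Prop := ∀ s ∈ ρ.support, Q s

/-- `ρ` simulates the abstract distribution `μ` up to the relation `R`. This is the dual
form of the existence of a coupling of `μ` and `ρ` that is concentrated on `R`: whenever `f` is
dominated by `g` along `R`, the expectation of `f` is at most that of `g`. -/
def Sim {Ω : Type*} (μ : PMF Ω) (ρ : PMF State) (R : Ω → State → Prop) : Prop :=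
  ∀ (f : Ω → ℝ≥0∞) (g : State → ℝ≥0∞), (∀ a s, R a s → f a ≤ g s) → expect μ f ≤ expect ρ g

section Sim

variable {Ω Ω' : Type*} {μ : PMF Ω} {ρ : PMF State} {R : Ω → State → Prop}

theorem Sim.bind {μ' : Ω → PMF Ω'} {k : State → PMF State} {R' : Ω' → State → Prop}
    (h : Sim μ ρ R) (h' : ∀ a s, R a s → Sim (μ' a) (k s) R') :
    Sim (μ.bind μ') (ρ.bind k) R' := by
  intro f g hfg
  rw [expect_bind, expect_bind]
  exact h _ _ fun a s has => h' a s has f g hfg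

theorem Sim.of_ensures {a : Ω} (h : Ensures ρ (R a)) : Sim (PMF.pure a) ρ R := by
  intro f g hfg
  rw [expect_pure, ← expect_const ρ (f a)]
  exact expect_mono_support fun s hs => hfg a s (h s hs)

/-- Steps before the simulated part need not be deterministic, only their outcomes controlled. -/
theorem Sim.bind_left {Q : State → Prop} {k : State → PMF State}
    (h : Ensures ρ Q) (h' : ∀ s, Q s → Sim μ (k s) R) : Sim μ (ρ.bind k) R := by
  have := Sim.bind (μ := PMF.pure ()) (μ' := fun _ => μ) (R := fun _ s => Q s) (R' := R)
    (Sim.of_ensures h) fun _ s hs => h' s hs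
  rwa [PMF.pure_bind] at this

theorem Sim.bind_right {R' : Ω → State → Prop} {k : State → PMF State}
    (h : Sim μ ρ R) (h' : ∀ a s, R a s → Ensures (k s) (R' a)) : Sim μ (ρ.bind k) R' := by
  have := Sim.bind (μ' := PMF.pure) (R' := R') h fun a s hs => Sim.of_ensures (h' a s hs)
  rwa [PMF.bind_pure] at this

theorem Sim.map {t : Ω → Ω'} {R' : Ω' → State → Prop} (h : Sim μ ρ fun a s => R' (t a) s) :
    Sim (μ.map t) ρ R' := by
  intro f g hfg
  rw [expect_map]
  exact h _ _ fun a s has => hfg _ s has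

theorem Sim.mono {R' : Ω → State → Prop} (h : Sim μ ρ R) (hR : ∀ a s, R a s → R' a s) :
    Sim μ ρ R' :=
  fun f g hfg => h f g fun a s has => hfg a s (hR a s has)

theorem Sim.ensures (h : Sim μ ρ R) : Ensures ρ fun s => ∃ a, R a s := by
  classical
  have h1 := h (fun _ => 1) ({s | ∃ a, R a s}.indicator 1) fun a s has => by
    rw [Set.indicator_of_mem (show s ∈ {s | ∃ a, R a s} from ⟨a, has⟩)]
    rfl
  rw [expect_const, ← toOuterMeasure_eq_expect] at h1
  have h2 : ρ.toOuterMeasure {s | ∃ a, R a s} = 1 := by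
    refine le_antisymm ?_ h1
    rw [← (PMF.toOuterMeasure_apply_eq_one_iff ρ _).2 (Set.subset_univ _)]
    exact MeasureTheory.measure_mono (Set.subset_univ _)
  exact fun s hs => (PMF.toOuterMeasure_apply_eq_one_iff ρ _).1 h2 hs

theorem Sim.le_toOuterMeasure (h : Sim μ ρ R) {t : Set Ω} {u : Set State}
    (htu : ∀ a s, R a s → a ∈ t → s ∈ u) : μ.toOuterMeasure t ≤ ρ.toOuterMeasure u := by
  rw [toOuterMeasure_eq_expect, toOuterMeasure_eq_expect]
  refine h _ _ fun a s has => ?_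
  by_cases ha : a ∈ t
  · simp [ha, htu a s has ha]
  · simp [ha]

/-- The invariant rule for the repetition of a random transition. -/
theorem Sim.iter {g : Ω → PMF Ω} {f : State → PMF State} {R : ℕ → Ω → State → Prop} {n : ℕ}
    (h : ∀ k < n, ∀ a s, R k a s → Sim (g a) (f s.tick) (R (k + 1)))
    {a : Ω} {s : State} (h0 : R 0 a s) : Sim (iterM g n a) (iter f n s) (R n) := by
  induction n generalizing R a s with
  | zero =>
    refine Sim.of_ensures fun t ht => ?_
    rw [WordRAM.iter, PMF.mem_support_pure_iff] at ht
    rwa [ht]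
  | succ n ih =>
    exact Sim.bind (h 0 (by omega) a s h0) fun b t hb =>
      ih (R := fun k => R (k + 1)) (fun k hk => h (k + 1) (by omega)) hb

end Sim

section Ensures

variable {w : ℕ} {ε : ℝ} {Q : State → Prop} {s : State}

theorem Ensures.mono {ρ : PMF State} {Q' : State → Prop} (h : Ensures ρ Q)
    (hQ : ∀ s, Q s → Q' s) : Ensures ρ Q' :=
  fun s hs => hQ s (h s hs)

theorem ensures_pure : Ensures (PMF.pure s) Q ↔ Q s := by
  simp [Ensures]

theorem ensures_seq {c d : Prog} :
    Ensures ((c.seq d).run w ε s) Q ↔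
      Ensures (c.run w ε s) fun t => Ensures (d.run w ε t) Q := by
  simp only [Ensures, Prog.run, PMF.mem_support_bind_iff]
  exact ⟨fun h t ht u hu => h u ⟨t, ht, hu⟩, fun h u ⟨t, ht, hu⟩ => h t ht u hu⟩

theorem ensures_skip : Ensures (Prog.skip.run w ε s) Q ↔ Q s.tick := ensures_pure

theorem ensures_const {x n : ℕ} :
    Ensures ((Prog.const x n).run w ε s) Q ↔ Q (s.tick.setReg x (n % 2 ^ w)) := ensures_pure

theorem ensures_arith {o : Op} {x y z : ℕ} :
    Ensures ((Prog.arith o x y z).run w ε s) Q ↔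
      Q (s.tick.setReg x (o.eval w (s.reg y) (s.reg z))) := ensures_pure

theorem ensures_load {x y : ℕ} :
    Ensures ((Prog.load x y).run w ε s) Q ↔ Q (s.tick.setReg x (s.mem (s.reg y))) := ensures_pure

theorem ensures_store {x y : ℕ} :
    Ensures ((Prog.store x y).run w ε s) Q ↔ Q (s.tick.setMem (s.reg x) (s.reg y)) := ensures_pure

theorem ensures_ifLt {x y : ℕ} {c d : Prog} :
    Ensures ((Prog.ifLt x y c d).run w ε s) Q ↔
      if s.reg x < s.reg y then Ensures (c.run w ε s.tick) Q
      else Ensures (d.run w ε s.tick) Q := by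
  simp only [Prog.run]
  split_ifs <;> rfl

theorem ensures_ifEps {x y : ℕ} {c d : Prog} :
    Ensures ((Prog.ifEps x y c d).run w ε s) Q ↔
      (ε * (s.reg x : ℝ) ≤ (s.reg y : ℝ) → Ensures (c.run w ε s.tick) Q) ∧
      (¬ ε * (s.reg x : ℝ) ≤ (s.reg y : ℝ) → Ensures (d.run w ε s.tick) Q) := by
  simp only [Prog.run]
  split_ifs with h <;> simp [h]

theorem ensures_iter {f : State → PMF State} {I : ℕ → State → Prop} {n : ℕ}
    (h : ∀ k < n, ∀ s, I k s → Ensures (f s.tick) (I (k + 1))) (h0 : I 0 s) :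
    Ensures (iter f n s) (I n) := by
  have := Sim.iter (g := fun _ : Unit => PMF.pure ()) (f := f) (R := fun k _ s => I k s) (n := n)
    (a := ()) (s := s) (fun k hk _ s hs => Sim.of_ensures (h k hk s hs)) h0
  exact this.ensures.mono fun s ⟨_, hs⟩ => hs

/-- The invariant rule for a counted loop. -/
theorem ensures_loop {x : ℕ} {c : Prog} (I : ℕ → State → Prop) (h0 : I 0 s.tick)
    (h : ∀ k < s.reg x, ∀ t, I k t → Ensures (c.run w ε t.tick) (I (k + 1)))
    (hQ : ∀ t, I (s.reg x) t → Q t) : Ensures ((Prog.loop x c).run w ε s) Q :=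
  (ensures_iter h h0).mono hQ

end Ensures

/-! ### Random strings and blocks of instructions -/

/-- Sequential composition of a list of programs. -/
def block : List Prog → Prog
  | [] => .skip
  | c :: cs => c.seq (block cs)

theorem ensures_block_nil {w : ℕ} {ε : ℝ} {Q : State → Prop} {s : State} :
    Ensures ((block []).run w ε s) Q ↔ Q s.tick := ensures_pure

theorem ensures_block_cons {w : ℕ} {ε : ℝ} {Q : State → Prop} {s : State} {c : Prog}
    {cs : List Prog} :
    Ensures ((block (c :: cs)).run w ε s) Q ↔
      Ensures (c.run w ε s) fun t => Ensures ((block cs).run w ε t) Q := ensures_seq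

/-- A random instruction is simulated by its own distribution. -/
theorem sim_rand {w : ℕ} {ε : ℝ} {s : State} {x y : ℕ} :
    Sim (uniformBelow (s.reg y)) ((Prog.rand x y).run w ε s)
      fun b t => b < s.reg y - 1 + 1 ∧ t = s.tick.setReg x b := by
  intro f g hfg
  rw [Prog.run, expect_map]
  exact expect_mono_support fun b hb => hfg _ _ ⟨lt_of_mem_support_uniformBelow hb, rfl⟩

/-- Registers below `20` hold parameters, the others are scratch registers. -/
theorem update_scratch {x y : ℕ} (hx : x < 20) (hy : 20 ≤ y) (f : ℕ → ℕ) (v : ℕ) :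
    Function.update f y v x = f x :=
  Function.update_of_ne (by omega) _ _

/-- The states `s` and `t` agree in the parameter registers. -/
def SameParams (s t : State) : Prop := ∀ x < 20, t.reg x = s.reg x

theorem SameParams.trans {s t u : State} (h : SameParams s t) (h' : SameParams t u) :
    SameParams s u :=
  fun x hx => (h' x hx).trans (h x hx)

/-- One step of drawing a random string: the next entry is drawn. -/
noncomputable def drawStep (v : ℕ) (z : ℕ × (ℕ → ℕ)) : PMF (ℕ × (ℕ → ℕ)) :=
  (uniformBelow v).map fun b => (z.1 + 1, Function.update z.2 z.1 b)

/-- Fill the string region, whose address is in register `7`, with random numbers below the value of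
register `y`. -/
def fill (y : ℕ) : Prog :=
  block [.const 20 0, .loop 1 (block [.rand 21 y, .arith .add 22 7 20, .store 22 21,
    .arith .add 20 20 3])]

theorem fill_spec {w : ℕ} {ε : ℝ} {y : ℕ} (hy : y < 20) {s : State} {q S : ℕ} (h1 : s.reg 1 = q)
    (h3 : s.reg 3 = 1) (h7 : s.reg 7 = S) (hS : S + q < 2 ^ w) (f₀ : ℕ → ℕ) :
    Sim (iterM (drawStep (s.reg y)) q (0, f₀)) ((fill y).run w ε s) fun z t =>
      SameParams s t ∧ (∀ k < q, t.mem (S + k) = z.2 k ∧ z.2 k < s.reg y - 1 + 1) ∧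
      (∀ a, a < S ∨ S + q ≤ a → t.mem a = s.mem a) ∧ t.time ≤ s.time + 6 * q + 3 := by
  have hpos : 0 < 2 ^ w := by positivity
  unfold fill
  refine Sim.bind_left (Q := fun t => SameParams s t ∧ t.reg 20 = 0 ∧ t.mem = s.mem ∧
    t.time = s.time + 1) ?_ fun s₁ hs₁ => ?_
  · rw [ensures_const]
    refine ⟨fun x hx => update_scratch hx (by norm_num) _ _, ?_, rfl, rfl⟩
    simp [State.setReg]
  refine Sim.bind_right (R := fun z t =>
      SameParams s t ∧ (∀ k < q, t.mem (S + k) = z.2 k ∧ z.2 k < s.reg y - 1 + 1) ∧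
      (∀ a, a < S ∨ S + q ≤ a → t.mem a = s.mem a) ∧ t.time ≤ s.time + 6 * q + 2) ?_
      fun z t ht => ?_
  swap
  · rw [ensures_block_nil]
    refine ⟨ht.1, ht.2.1, ht.2.2.1, ?_⟩
    have := ht.2.2.2
    simp only [State.tick]
    omega
  obtain ⟨hs₁, h20, hm, ht⟩ := hs₁
  have hq : s₁.reg 1 = q := by rw [hs₁ 1 (by norm_num), h1]
  rw [Prog.run, hq]
  refine (Sim.iter (R := fun i z t => SameParams s t ∧ t.reg 20 = i ∧ z.1 = i ∧
    (∀ k < i, t.mem (S + k) = z.2 k ∧ z.2 k < s.reg y - 1 + 1) ∧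
    (∀ a, a < S ∨ S + q ≤ a → t.mem a = s.mem a) ∧ t.time ≤ s.time + 6 * i + 2) ?_ ?_).mono ?_
  · intro i hi z t ⟨hp, h20, hz, hk, ha, ht⟩
    have hy' : t.tick.reg y = s.reg y := hp y hy
    have key := Sim.bind_right (sim_rand (w := w) (ε := ε) (s := t.tick) (x := 21) (y := y))
      (k := (block [.arith .add 22 7 20, .store 22 21, .arith .add 20 20 3]).run w ε)
      (R' := fun b t' => SameParams s t' ∧ t'.reg 20 = i + 1 ∧ (b < s.reg y - 1 + 1) ∧
        t'.mem = Function.update t.mem (S + i) b ∧ t'.time ≤ s.time + 6 * (i + 1) + 2) ?_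
    · rw [hy'] at key
      refine Sim.map (key.mono ?_)
      rintro b t' ⟨k1, k2, k3, k4, k5⟩
      refine ⟨k1, k2, by simp [hz], ?_, ?_, k5⟩
      · intro k hki
        rw [k4, hz]
        rcases Nat.lt_succ_iff_lt_or_eq.1 hki with h | rfl
        · simp only [Function.update_of_ne (show S + k ≠ S + i by omega),
            Function.update_of_ne (show k ≠ i by omega)]
          exact hk k h
        · simpa using k3
      · intro a haa
        rw [k4, Function.update_of_ne (by omega)]
        exact ha a haa
    · rintro b t' ⟨hb, rfl⟩
      rw [hy'] at hb
      have e1 : (S + i) % 2 ^ w = S + i := Nat.mod_eq_of_lt (by omega)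
      have e2 : (i + 1) % 2 ^ w = i + 1 := Nat.mod_eq_of_lt (by omega)
      have e7 : t.reg 7 = S := (hp 7 (by norm_num)).trans h7
      have e3 : t.reg 3 = 1 := (hp 3 (by norm_num)).trans h3
      simp [↓ensures_block_cons, ↓ensures_block_nil, ↓ensures_arith, ↓ensures_store, State.tick,
        State.setReg, State.setMem, Op.eval, e7, e3, e1, e2, h20, hb]
      refine ⟨fun x hx => ?_, by omega⟩
      simp [update_scratch, hx, hp x hx]
  · exact ⟨hs₁, h20, rfl, by simp, by simp [State.tick, hm], by simp [State.tick, ht]⟩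
  · rintro z t ⟨k1, -, -, k2, k3, k4⟩
    exact ⟨k1, k2, k3, k4⟩

/-! ### Distances to a string, and loops over pairs -/

/-- Registers `1`, `3`, `7` hold the length `q` of the vectors, the constant `1` and the address of a
string. For each of the vectors `x < reg rn`, whose entry `k` is stored at address
`reg rb + x * reg rso + k * reg rsi`, store its Hamming distance to the string at address
`reg rd + x`. -/
def sketch (rn rb rso rsi rd : ℕ) : Prog :=
  block [.const 20 0, .loop rn (block [
    .arith .mul 21 20 rso, .arith .add 21 21 rb, .const 22 0, .const 23 0,
    .loop 1 (block [.load 24 21, .arith .add 25 7 23, .load 25 25,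
      .arith .sub 26 24 25, .arith .sub 27 25 24, .arith .add 26 26 27,
      .arith .add 22 22 26, .arith .add 21 21 rsi, .arith .add 23 23 3]),
    .arith .add 25 rd 20, .store 25 22, .arith .add 20 20 3])]

/-- The Hamming distance of two 0-1 sequences on the first `q` places, as a sum of absolute
differences. -/
def distTo (q : ℕ) (a σ : ℕ → ℕ) : ℕ := ∑ k ∈ Finset.range q, Nat.dist (a k) (σ k)

theorem distTo_le {q : ℕ} {a σ : ℕ → ℕ} (ha : ∀ k < q, a k ≤ 1) (hσ : ∀ k < q, σ k ≤ 1) :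
    distTo q a σ ≤ q := by
  calc distTo q a σ ≤ ∑ k ∈ Finset.range q, 1 := by
        refine Finset.sum_le_sum fun k hk => ?_
        have h1 := ha k (Finset.mem_range.1 hk)
        have h2 := hσ k (Finset.mem_range.1 hk)
        unfold Nat.dist
        omega
    _ = q := by simp

theorem sketch_spec {w : ℕ} {ε : ℝ} {rn rb rso rsi rd : ℕ} (hrn : rn < 20) (hrb : rb < 20)
    (hrso : rso < 20) (hrsi : rsi < 20) (hrd : rd < 20) {s : State} {n b so si d q S : ℕ}
    (hn : s.reg rn = n) (hb : s.reg rb = b) (hso : s.reg rso = so) (hsi : s.reg rsi = si)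
    (hd : s.reg rd = d) (h1 : s.reg 1 = q) (h3 : s.reg 3 = 1) (h7 : s.reg 7 = S)
    {M : ℕ → ℕ → ℕ} {σ : ℕ → ℕ}
    (hM : ∀ x < n, ∀ k < q, s.mem (b + x * so + k * si) = M x k ∧ M x k ≤ 1)
    (hMd : ∀ x < n, ∀ k < q, b + x * so + k * si < d)
    (hσ : ∀ k < q, s.mem (S + k) = σ k ∧ σ k ≤ 1) (hS : S + q ≤ d)
    (hw : d + n < 2 ^ w) (hw' : b + n * so + q * si < 2 ^ w) :
    Ensures ((sketch rn rb rso rsi rd).run w ε s) fun t =>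
      SameParams s t ∧ (∀ x < n, t.mem (d + x) = distTo q (M x) σ) ∧
      (∀ a, a < d ∨ d + n ≤ a → t.mem a = s.mem a) ∧ t.time ≤ s.time + n * (11 * q + 10) + 3 := by
  have hpos : 0 < 2 ^ w := by positivity
  unfold sketch
  rw [ensures_block_cons, ensures_const, ensures_block_cons]
  refine ensures_loop (fun i t => SameParams s t ∧ t.reg 20 = i ∧
    (∀ x < i, t.mem (d + x) = distTo q (M x) σ) ∧
    (∀ a, a < d ∨ d + n ≤ a → t.mem a = s.mem a) ∧ t.time ≤ s.time + i * (11 * q + 10) + 2) ?_ ?_ ?_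
  · refine ⟨fun x hx => ?_, ?_, by simp, ?_, ?_⟩ <;>
      simp [State.tick, State.setReg, update_scratch, *]
  · have : (s.tick.setReg 20 (0 % 2 ^ w)).reg rn = n := by
      simp [State.tick, State.setReg, update_scratch, hrn, hn]
    rw [this]
    intro i hi t ⟨hp, h20, hF, ha, ht⟩
    have b1 : i * so ≤ n * so := Nat.mul_le_mul_right _ hi.le
    have e1 : i * so % 2 ^ w = i * so := Nat.mod_eq_of_lt (by omega)
    have e2 : (i * so + b) % 2 ^ w = i * so + b := Nat.mod_eq_of_lt (by omega)
    have f1 := (hp 1 (by norm_num)).trans h1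
    have f3 := (hp 3 (by norm_num)).trans h3
    have f7 := (hp 7 (by norm_num)).trans h7
    have fb := (hp rb hrb).trans hb
    have fso := (hp rso hrso).trans hso
    have fsi := (hp rsi hrsi).trans hsi
    have fd := (hp rd hrd).trans hd
    simp only [↓ensures_block_cons, ↓ensures_block_nil, ↓ensures_arith, ↓ensures_const,
      State.tick, State.setReg, Op.eval]
    refine ensures_loop (fun k t' => SameParams s t' ∧ t'.reg 20 = i ∧
      t'.reg 21 = b + i * so + k * si ∧ t'.reg 22 = distTo k (M i) σ ∧ t'.reg 23 = k ∧
      t'.mem = t.mem ∧ t'.time ≤ t.time + 11 * k + 6) ?_ ?_ ?_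
    · simp only [State.tick]
      refine ⟨fun x hx => ?_, ?_, ?_, ?_, ?_, ?_, ?_⟩ <;>
        simp [update_scratch, distTo, *]
      · exact hp x hx
      · ring
    · simp only [update_scratch (show 1 < 20 by norm_num) (show 20 ≤ 23 by norm_num),
        update_scratch (show 1 < 20 by norm_num) (show 20 ≤ 22 by norm_num),
        update_scratch (show 1 < 20 by norm_num) (show 20 ≤ 21 by norm_num), f1]
      intro k hk t' ⟨hp', g20, g21, g22, g23, gm, gt⟩
      have g1 := (hp' 1 (by norm_num)).trans h1
      have g3 := (hp' 3 (by norm_num)).trans h3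
      have g7 := (hp' 7 (by norm_num)).trans h7
      have gsi := (hp' rsi hrsi).trans hsi
      have m1 : t.mem (b + i * so + k * si) = M i k := by
        rw [ha _ (Or.inl (hMd i hi k hk)), (hM i hi k hk).1]
      have m2 : t.mem (S + k) = σ k := by
        rw [ha _ (Or.inl (by omega)), (hσ k hk).1]
      have d1 : distTo (k + 1) (M i) σ = distTo k (M i) σ + (M i k - σ k + (σ k - M i k)) := by
        simp [distTo, Finset.sum_range_succ, Nat.dist]
      have d2 : distTo (k + 1) (M i) σ ≤ k + 1 :=
        distTo_le (fun x hx => (hM i hi x (by omega)).2) (fun x hx => (hσ x (by omega)).2)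
      have e3 : (S + k) % 2 ^ w = S + k := Nat.mod_eq_of_lt (by omega)
      have e4 : (M i k - σ k + (σ k - M i k)) % 2 ^ w = M i k - σ k + (σ k - M i k) :=
        Nat.mod_eq_of_lt (by omega)
      have e5 : (distTo k (M i) σ + (M i k - σ k + (σ k - M i k))) % 2 ^ w
          = distTo (k + 1) (M i) σ := by
        rw [d1]
        exact Nat.mod_eq_of_lt (by omega)
      have e6 : (b + i * so + k * si + si) % 2 ^ w = b + i * so + (k + 1) * si := by
        rw [show b + i * so + k * si + si = b + i * so + (k + 1) * si by ring]
        have b2 : (k + 1) * si ≤ q * si := Nat.mul_le_mul_right _ hk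
        exact Nat.mod_eq_of_lt (by omega)
      have e7 : (k + 1) % 2 ^ w = k + 1 := Nat.mod_eq_of_lt (by omega)
      simp [↓ensures_block_cons, ↓ensures_block_nil, ↓ensures_arith, ↓ensures_load, State.tick,
        State.setReg, Op.eval, update_scratch, hrsi, g7, g3, g20, g21, g22, g23, m1, m2, gsi,
        e3, e4, e5, e6, e7, gm]
      refine ⟨fun x hx => ?_, by omega⟩
      simp [update_scratch, hx, hp' x hx]
    · simp only [update_scratch (show 1 < 20 by norm_num) (show 20 ≤ 23 by norm_num),
        update_scratch (show 1 < 20 by norm_num) (show 20 ≤ 22 by norm_num),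
        update_scratch (show 1 < 20 by norm_num) (show 20 ≤ 21 by norm_num), f1]
      intro t' ⟨hp', g20, g21, g22, g23, gm, gt⟩
      have g3 := (hp' 3 (by norm_num)).trans h3
      have gd := (hp' rd hrd).trans hd
      have e3 : (d + i) % 2 ^ w = d + i := Nat.mod_eq_of_lt (by omega)
      have e4 : (i + 1) % 2 ^ w = i + 1 := Nat.mod_eq_of_lt (by omega)
      simp [↓ensures_store, State.tick, State.setMem, g20, g22, g3, gd, e3, e4, gm]
      refine ⟨fun x hx => ?_, fun x hx => ?_, fun a haa => ?_, ?_⟩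
      · simp [update_scratch, hx, hp' x hx]
      · rcases (show x < i ∨ x = i by omega) with h | rfl
        · rw [Function.update_of_ne (by omega)]
          exact hF x h
        · simp
      · rw [Function.update_of_ne (by omega)]
        exact ha a haa
      · rw [Nat.add_mul]
        omega
  · have : (s.tick.setReg 20 (0 % 2 ^ w)).reg rn = n := by
      simp [State.tick, State.setReg, update_scratch, hrn, hn]
    rw [this]
    rintro t ⟨k1, -, k2, k3, k4⟩
    rw [ensures_block_nil]
    exact ⟨k1, k2, k3, by simp only [State.tick]; omega⟩

/-- For all pairs `(i, j)` with `i < p`, `j < r`, in lexicographic order, execute `body` with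
`i * r + j` in register `21` and the distances belonging to row `i` and to column `j` in the
registers `22` and `24`. -/
def forPairs (body : Prog) : Prog :=
  block [.const 20 0, .const 21 0, .loop 0 (block [.arith .add 22 8 20, .load 22 22, .const 23 0,
    .loop 2 (block [.arith .add 24 9 23, .load 24 24, body, .arith .add 21 21 3,
      .arith .add 23 23 3]),
    .arith .add 20 20 3])]

/-- If `body` turns the two cells of the pair with index `e`, at distance `p * r`, into `v₁ e` and
`v₂ e`, then `forPairs body` does this for all pairs. -/
theorem forPairs_spec {w : ℕ} {ε : ℝ} {body : Prog} {s : State} {p r O S dF dG : ℕ}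
    (h0 : s.reg 0 = p) (h2 : s.reg 2 = r) (h3 : s.reg 3 = 1) (h8 : s.reg 8 = dF)
    (h9 : s.reg 9 = dG) (hS : O + p * r + p * r = S) (hF : S ≤ dF) (hG : dF + p ≤ dG)
    (hw : dG + r < 2 ^ w) {F G : ℕ → ℕ} (hFm : ∀ i < p, s.mem (dF + i) = F i)
    (hGm : ∀ j < r, s.mem (dG + j) = G j) {v₁ v₂ : ℕ → ℕ}
    (hbody : ∀ t, ∀ e < p * r, SameParams s t → t.reg 21 = e → t.reg 22 = F (e / r) →
      t.reg 24 = G (e % r) → t.mem (O + e) = s.mem (O + e) →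
      t.mem (O + p * r + e) = s.mem (O + p * r + e) →
      Ensures (body.run w ε t) fun t' => SameParams s t' ∧
        (∀ x, 20 ≤ x → x < 25 → t'.reg x = t.reg x) ∧ t'.mem (O + e) = v₁ e ∧
        t'.mem (O + p * r + e) = v₂ e ∧
        (∀ a, a ≠ O + e → a ≠ O + p * r + e → t'.mem a = t.mem a) ∧ t'.time ≤ t.time + 25) :
    Ensures ((forPairs body).run w ε s) fun t => SameParams s t ∧
      (∀ e < p * r, t.mem (O + e) = v₁ e ∧ t.mem (O + p * r + e) = v₂ e) ∧
      (∀ a, a < O ∨ S ≤ a → t.mem a = s.mem a) ∧ t.time ≤ s.time + p * (31 * r + 7) + 4 := by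
  have hpos : 0 < 2 ^ w := by positivity
  unfold forPairs
  -- the state when the first `e` pairs have been treated
  let Done (e : ℕ) (t : State) : Prop := SameParams s t ∧ t.reg 21 = e ∧
    (∀ e' < e, t.mem (O + e') = v₁ e' ∧ t.mem (O + p * r + e') = v₂ e') ∧
    (∀ e', e ≤ e' → e' < p * r → t.mem (O + e') = s.mem (O + e') ∧
      t.mem (O + p * r + e') = s.mem (O + p * r + e')) ∧
    (∀ a, a < O ∨ S ≤ a → t.mem a = s.mem a)
  rw [ensures_block_cons, ensures_const, ensures_block_cons, ensures_const, ensures_block_cons]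
  have hp0 : (((s.tick.setReg 20 (0 % 2 ^ w)).tick).setReg 21 (0 % 2 ^ w)).reg 0 = p := by
    simp [State.tick, State.setReg, h0]
  refine ensures_loop (fun i t => Done (i * r) t ∧ t.reg 20 = i ∧
    t.time ≤ s.time + i * (31 * r + 7) + 3) ?_ ?_ ?_
  · refine ⟨⟨fun x hx => ?_, ?_, ?_, ?_, ?_⟩, ?_, ?_⟩ <;>
      simp [State.tick, State.setReg, update_scratch, *]
  · rw [hp0]
    intro i hi t ⟨⟨hp, h21, hnew, hold, ha⟩, h20, ht⟩
    have f2 := (hp 2 (by norm_num)).trans h2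
    have f8 := (hp 8 (by norm_num)).trans h8
    have e1 : (dF + i) % 2 ^ w = dF + i := Nat.mod_eq_of_lt (by omega)
    have m1 : t.mem (dF + i) = F i := by rw [ha _ (by omega), hFm i hi]
    simp only [↓ensures_block_cons, ↓ensures_block_nil, ↓ensures_arith, ↓ensures_const,
      ↓ensures_load, State.tick, State.setReg, Op.eval]
    refine ensures_loop (fun j t' => Done (i * r + j) t' ∧ t'.reg 20 = i ∧ t'.reg 22 = F i ∧
      t'.reg 23 = j ∧ t'.time ≤ t.time + 31 * j + 5) ?_ ?_ ?_
    · refine ⟨⟨fun x hx => ?_, ?_, ?_, ?_, ?_⟩, ?_, ?_, ?_, ?_⟩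
      · simp [State.tick, update_scratch, hx, hp x hx]
      · simp [State.tick, h21]
      · simpa [State.tick] using hnew
      · simpa [State.tick] using hold
      · simpa [State.tick] using ha
      all_goals simp [State.tick, h20, f8, e1, m1]
    · have : (2 : ℕ) < 20 := by norm_num
      simp only [update_scratch this (show 20 ≤ 23 by norm_num),
        update_scratch this (show 20 ≤ 22 by norm_num), f2]
      intro j hj t' ⟨⟨hp', g21, gnew, gold, ga⟩, g20, g22, g23, gt⟩
      have g3 := (hp' 3 (by norm_num)).trans h3
      have g9 := (hp' 9 (by norm_num)).trans h9
      have hlt : i * r + j < p * r := by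
        have := Nat.mul_le_mul_right r (show i + 1 ≤ p from hi)
        rw [Nat.add_mul] at this
        omega
      have e2 : (dG + j) % 2 ^ w = dG + j := Nat.mod_eq_of_lt (by omega)
      have e3 : (i * r + j + 1) % 2 ^ w = i * r + j + 1 := Nat.mod_eq_of_lt (by omega)
      have e4 : (j + 1) % 2 ^ w = j + 1 := Nat.mod_eq_of_lt (by omega)
      have m2 : t'.mem (dG + j) = G j := by rw [ga _ (by omega), hGm j hj]
      have c1 : (i * r + j) / r = i := by
        rw [mul_comm, Nat.mul_add_div (by omega), Nat.div_eq_of_lt hj, add_zero]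
      have c2 : (i * r + j) % r = j := by
        rw [mul_comm, Nat.mul_add_mod, Nat.mod_eq_of_lt hj]
      simp only [↓ensures_block_cons, ↓ensures_arith, ↓ensures_load, State.tick,
        State.setReg, Op.eval]
      refine (hbody _ (i * r + j) hlt (fun x hx => ?_) ?_ ?_ ?_ ?_ ?_).mono ?_
      · simp [update_scratch, hx, hp' x hx]
      · simp [g21]
      · simp [g22, c1]
      · simp [g23, g9, e2, m2, c2]
      · exact (gold _ le_rfl hlt).1
      · exact (gold _ le_rfl hlt).2
      rintro u ⟨up, ur, u1, u2, um, ut⟩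
      have u3 := (up 3 (by norm_num)).trans h3
      have u20 := ur 20 (by norm_num) (by norm_num)
      have u21 := ur 21 (by norm_num) (by norm_num)
      have u22 := ur 22 (by norm_num) (by norm_num)
      have u23 := ur 23 (by norm_num) (by norm_num)
      simp [g20, g21, g22, g23] at u20 u21 u22 u23 um ut
      simp [↓ensures_block_nil, State.tick, u20, u21, u22, u23, u3, e3, e4]
      refine ⟨⟨fun x hx => ?_, ?_, fun e' he' => ?_, fun e' he' he'' => ?_, fun a haa => ?_⟩, ?_⟩
      · simp [update_scratch, hx, up x hx]
      · simp [add_assoc]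
      · rcases (show e' < i * r + j ∨ e' = i * r + j by omega) with h | rfl
        · have := gnew e' h
          simp only [um _ (show O + e' ≠ O + (i * r + j) by omega)
            (show O + e' ≠ O + p * r + (i * r + j) by omega),
            um _ (show O + p * r + e' ≠ O + (i * r + j) by omega)
            (show O + p * r + e' ≠ O + p * r + (i * r + j) by omega)]
          exact this
        · exact ⟨u1, u2⟩
      · have := gold e' (by omega) he''
        simp only [um _ (show O + e' ≠ O + (i * r + j) by omega)
            (show O + e' ≠ O + p * r + (i * r + j) by omega),
            um _ (show O + p * r + e' ≠ O + (i * r + j) by omega)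
            (show O + p * r + e' ≠ O + p * r + (i * r + j) by omega)]
        exact this
      · simp only [um a (by omega) (by omega)]
        exact ga a haa
      · omega
    · have : (2 : ℕ) < 20 := by norm_num
      simp only [update_scratch this (show 20 ≤ 23 by norm_num),
        update_scratch this (show 20 ≤ 22 by norm_num), f2]
      intro t' ⟨⟨hp', g21, gnew, gold, ga⟩, g20, g22, g23, gt⟩
      have g3 := (hp' 3 (by norm_num)).trans h3
      have e4 : (i + 1) % 2 ^ w = i + 1 := Nat.mod_eq_of_lt (by omega)
      rw [← Nat.succ_mul] at gnew gold g21
      simp [g20, g3, e4]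
      refine ⟨⟨fun x hx => ?_, ?_, gnew, gold, ga⟩, ?_⟩
      · simp [update_scratch, hx, hp' x hx]
      · simpa using g21
      · rw [Nat.add_mul]
        omega
  · rw [hp0]
    rintro t ⟨⟨k1, -, k2, -, k3⟩, -, k4⟩
    rw [ensures_block_nil]
    exact ⟨k1, k2, k3, by simp only [State.tick]; omega⟩

/-! ### Concentration and rounding -/

/-- Adding a random sign times `c` to `x` changes the exponential of a quadratic form in a
controlled way. -/
theorem exp_sq_average_le (a x c : ℝ) :
    (Real.exp (a * (x + c) ^ 2) + Real.exp (a * (x - c) ^ 2)) / 2 ≤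
      Real.exp ((a + 2 * a ^ 2 * c ^ 2) * x ^ 2 + a * c ^ 2) := by
  have h := Real.cosh_le_exp_half_sq (2 * a * x * c)
  have e1 : Real.exp (a * (x + c) ^ 2) =
      Real.exp (a * x ^ 2 + a * c ^ 2) * Real.exp (2 * a * x * c) := by
    rw [← Real.exp_add]; ring_nf
  have e2 : Real.exp (a * (x - c) ^ 2) =
      Real.exp (a * x ^ 2 + a * c ^ 2) * Real.exp (-(2 * a * x * c)) := by
    rw [← Real.exp_add]; ring_nf
  have e3 : Real.exp ((a + 2 * a ^ 2 * c ^ 2) * x ^ 2 + a * c ^ 2) =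
      Real.exp (a * x ^ 2 + a * c ^ 2) * Real.exp ((2 * a * x * c) ^ 2 / 2) := by
    rw [← Real.exp_add]; ring_nf
  rw [e1, e2, e3, ← mul_add, mul_div_assoc, ← Real.cosh_eq]
  gcongr

/-- The sum of the coefficients `c i`, `i < n`, with random signs given by the bits `f i`. -/
noncomputable def signedSum (n : ℕ) (f : ℕ → ℕ) (c : ℕ → ℝ) : ℝ :=
  ∑ i ∈ Finset.range n, (1 - 2 * (f i : ℝ)) * c i

theorem signedSum_succ (n : ℕ) (f : ℕ → ℕ) (c : ℕ → ℝ) :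
    signedSum (n + 1) f c = signedSum n f c + (1 - 2 * (f n : ℝ)) * c n :=
  Finset.sum_range_succ _ _

theorem signedSum_update (n b : ℕ) (f : ℕ → ℕ) (c : ℕ → ℝ) :
    signedSum (n + 1) (Function.update f n b) c = signedSum n f c + (1 - 2 * (b : ℝ)) * c n := by
  rw [signedSum_succ, Function.update_self]
  congr 1
  refine Finset.sum_congr rfl fun i hi => ?_
  rw [Function.update_of_ne (Finset.mem_range.1 hi).ne]

/-- The inductive form of `expect_exp_signedSum_le`: `n` bits are still to be drawn, and `v` is the
sum of the squares of their coefficients. -/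
theorem expect_exp_signedSum_le_aux {l h : ℝ} (hl : |l| * h ≤ 1 / 8) {c : ℕ → ℝ} (n k : ℕ)
    (f : ℕ → ℕ) {v : ℝ} (hv : ∑ i ∈ Finset.range n, c (k + i) ^ 2 = v) (hvh : v ≤ h) :
    expect (iterM (drawStep 2) n (k, f))
        (fun z => ENNReal.ofReal (Real.exp (l * signedSum (k + n) z.2 c ^ 2))) ≤
      ENNReal.ofReal (Real.exp ((l + 8 * l ^ 2 * v) * signedSum k f c ^ 2
        + v * (l + 8 * l ^ 2 * h))) := by
  induction n generalizing k f v with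
  | zero =>
    simp only [Finset.range_zero, Finset.sum_empty] at hv
    simp [iterM, expect_pure, ← hv]
  | succ n ih =>
    rw [Finset.sum_range_succ', add_zero] at hv
    set u := ∑ i ∈ Finset.range n, c (k + (i + 1)) ^ 2 with hu
    have hu0 : 0 ≤ u := Finset.sum_nonneg fun i _ => sq_nonneg _
    have huh : u ≤ h := by nlinarith [sq_nonneg (c k)]
    have hih := fun b => ih (k + 1) (Function.update f k b) (v := u)
      (by rw [hu]; exact Finset.sum_congr rfl fun i _ => by congr 2; ring) huh
    rw [iterM, drawStep, expect_bind, expect_map, expect_uniformBelow_two]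
    rw [show k + (n + 1) = k + 1 + n by ring]
    refine le_trans (ENNReal.div_le_div_right (add_le_add (hih 0) (hih 1)) 2) ?_
    simp only [signedSum_update]
    rw [← ENNReal.ofReal_add (by positivity) (by positivity),
      show (2 : ℝ≥0∞) = ENNReal.ofReal 2 by simp, ← ENNReal.ofReal_div_of_pos (by norm_num)]
    refine ENNReal.ofReal_le_ofReal ?_
    set x := signedSum k f c
    set a := l + 8 * l ^ 2 * u with ha
    set B := u * (l + 8 * l ^ 2 * h)
    have key := exp_sq_average_le a x (c k)
    -- hence `2 a² ≤ 8 l²`, which is what the coefficient `l + 8 l² v` gains with a full sign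
    have hal : |a| ≤ 2 * |l| := by
      have h1 : 8 * l ^ 2 * u ≤ |l| := by
        rw [← sq_abs l]
        nlinarith [abs_nonneg l, mul_le_mul_of_nonneg_left huh (abs_nonneg l)]
      have h2 : |a| ≤ |l| + |8 * l ^ 2 * u| := abs_add_le _ _
      rw [abs_of_nonneg (by positivity : 0 ≤ 8 * l ^ 2 * u)] at h2
      linarith
    have ha2 : a ^ 2 ≤ 4 * l ^ 2 := by
      rw [← sq_abs a, ← sq_abs l]
      nlinarith [abs_nonneg a, abs_nonneg l]
    calc (Real.exp (a * (x + (1 - 2 * ((0 : ℕ) : ℝ)) * c k) ^ 2 + B)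
          + Real.exp (a * (x + (1 - 2 * ((1 : ℕ) : ℝ)) * c k) ^ 2 + B)) / 2
        = (Real.exp (a * (x + c k) ^ 2) + Real.exp (a * (x - c k) ^ 2)) / 2 * Real.exp B := by
          rw [Real.exp_add, Real.exp_add]
          push_cast
          ring_nf
      _ ≤ Real.exp ((a + 2 * a ^ 2 * c k ^ 2) * x ^ 2 + a * c k ^ 2) * Real.exp B := by gcongr
      _ = Real.exp ((a + 2 * a ^ 2 * c k ^ 2) * x ^ 2 + a * c k ^ 2 + B) :=
          (Real.exp_add _ _).symm
      _ ≤ _ := by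
          refine Real.exp_le_exp.2 ?_
          have h1 : a + 2 * a ^ 2 * c k ^ 2 ≤ l + 8 * l ^ 2 * v := by
            rw [← hv, ha]
            nlinarith [mul_le_mul_of_nonneg_right ha2 (sq_nonneg (c k))]
          have h2 : a * c k ^ 2 ≤ c k ^ 2 * (l + 8 * l ^ 2 * h) := by
            rw [mul_comm]
            refine mul_le_mul_of_nonneg_left ?_ (sq_nonneg _)
            rw [ha]
            nlinarith [mul_le_mul_of_nonneg_left huh (sq_nonneg l)]
          have h3 := mul_le_mul_of_nonneg_right h1 (sq_nonneg x)
          have h4 : v * (l + 8 * l ^ 2 * h) = B + c k ^ 2 * (l + 8 * l ^ 2 * h) := by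
            rw [← hv]; ring
          linarith

/-- The moment generating function of the square of a random signed sum, for small arguments of
either sign. -/
theorem expect_exp_signedSum_le {l h : ℝ} (hl : |l| * h ≤ 1 / 8) {c : ℕ → ℝ} {q : ℕ}
    (hc : ∑ i ∈ Finset.range q, c i ^ 2 = h) (f : ℕ → ℕ) :
    expect (iterM (drawStep 2) q (0, f))
        (fun z => ENNReal.ofReal (Real.exp (l * signedSum q z.2 c ^ 2))) ≤
      ENNReal.ofReal (Real.exp (l * h + 8 * (l * h) ^ 2)) := by
  have := expect_exp_signedSum_le_aux hl (c := c) q 0 f (v := h) (by simpa using hc) le_rfl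
  simp only [zero_add] at this
  refine this.trans (le_of_eq ?_)
  simp only [signedSum, Finset.range_zero, Finset.sum_empty]
  ring_nf

/-- The entries drawn are bits. -/
theorem le_one_of_mem_support_draw {n k : ℕ} {f : ℕ → ℕ} (hf : ∀ i < k, f i ≤ 1)
    {z : ℕ × (ℕ → ℕ)} (hz : z ∈ (iterM (drawStep 2) n (k, f)).support) :
    ∀ i < k + n, z.2 i ≤ 1 := by
  induction n generalizing k f with
  | zero =>
    rw [iterM, PMF.mem_support_pure_iff] at hz
    simpa [hz] using hf
  | succ n ih =>
    rw [iterM, PMF.mem_support_bind_iff] at hz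
    obtain ⟨y, hy, hz⟩ := hz
    rw [drawStep, PMF.mem_support_map_iff] at hy
    obtain ⟨b, hb, rfl⟩ := hy
    have hb' := lt_of_mem_support_uniformBelow hb
    intro i hi
    refine ih (fun j hj => ?_) hz i (by omega)
    rcases (show j < k ∨ j = k by omega) with h | rfl
    · simpa [h.ne] using hf j h
    · simp only [Function.update_self]
      omega

/-- One round of the abstract process: draw a random bit string of length `q` and add the increments that it determines to
both families of accumulators. -/
noncomputable def roundStep (q : ℕ) (inc₁ inc₂ : (ℕ → ℕ) → ℕ → ℕ) (ω : (ℕ → ℕ) × (ℕ → ℕ)) :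
    PMF ((ℕ → ℕ) × (ℕ → ℕ)) :=
  (iterM (drawStep 2) q (0, fun _ => 0)).map fun z =>
    (fun e => ω.1 e + inc₁ z.2 e, fun e => ω.2 e + inc₂ z.2 e)

/-- The moment generating function of an accumulator after `T` rounds. -/
theorem expect_exp_rounds_le {q T : ℕ} {inc₁ inc₂ : (ℕ → ℕ) → ℕ → ℕ} {l h : ℝ}
    (hl : |l| * h ≤ 1 / 8) {c : ℕ → ℝ} (hc : ∑ i ∈ Finset.range q, c i ^ 2 = h)
    {Y : (ℕ → ℕ) × (ℕ → ℕ) → ℕ} (hY0 : Y (fun _ => 0, fun _ => 0) = 0)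
    (hY : ∀ ω σ, (∀ k < q, σ k ≤ 1) →
      ((Y (fun e => ω.1 e + inc₁ σ e, fun e => ω.2 e + inc₂ σ e) : ℕ) : ℝ) =
        Y ω + signedSum q σ c ^ 2) :
    expect (iterM (roundStep q inc₁ inc₂) T (fun _ => 0, fun _ => 0))
        (fun ω => ENNReal.ofReal (Real.exp (l * Y ω))) ≤
      ENNReal.ofReal (Real.exp (T * (l * h + 8 * (l * h) ^ 2))) := by
  have := expect_iterM_le (g := roundStep q inc₁ inc₂)
    (f := fun ω => ENNReal.ofReal (Real.exp (l * Y ω)))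
    (M := ENNReal.ofReal (Real.exp (l * h + 8 * (l * h) ^ 2))) (fun ω => ?_) T
    (fun _ => 0, fun _ => 0)
  · refine this.trans (le_of_eq ?_)
    rw [hY0, Nat.cast_zero, mul_zero, Real.exp_zero, ENNReal.ofReal_one, mul_one,
      ← ENNReal.ofReal_pow (by positivity), ← Real.exp_nat_mul]
  · rw [roundStep, expect_map]
    calc _ ≤ expect (iterM (drawStep 2) q (0, fun _ => 0)) fun z =>
          ENNReal.ofReal (Real.exp (l * Y ω)) *
            ENNReal.ofReal (Real.exp (l * signedSum q z.2 c ^ 2)) := by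
          refine expect_mono_support fun z hz => ?_
          have hz' := le_one_of_mem_support_draw (by simp) hz
          rw [hY ω z.2 fun k hk => hz' k (by omega), mul_add, Real.exp_add,
            ENNReal.ofReal_mul (by positivity)]
      _ ≤ _ := by
          rw [expect_const_mul, mul_comm]
          gcongr
          exact expect_exp_signedSum_le hl hc _

/-- A Chernoff bound: a random natural number whose moment generating function is like that of a sum
of `T` squares of signed sums is concentrated around `T * h`. -/
theorem expect_deviation_le {Ω : Type*} {μ : PMF Ω} {Y : Ω → ℕ} {T h : ℕ} {δ : ℝ} (hδ : 0 < δ)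
    (hδ1 : δ ≤ 1)
    (hmgf : ∀ l : ℝ, |l| * h ≤ 1 / 8 → expect μ (fun ω => ENNReal.ofReal (Real.exp (l * Y ω))) ≤
      ENNReal.ofReal (Real.exp (T * (l * h + 8 * (l * h) ^ 2)))) :
    expect μ ({ω | δ * (T * h) < |(Y ω : ℝ) - T * h|}.indicator 1) ≤
      2 * ENNReal.ofReal (Real.exp (-(T * δ ^ 2 / 32))) := by
  set E := ENNReal.ofReal (Real.exp (-(T * δ ^ 2 / 32)))
  -- the exponential form of Markov's inequality
  have markov : ∀ l d : ℝ, |l| * h ≤ 1 / 8 →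
      T * (l * h + 8 * (l * h) ^ 2) - l * d ≤ -(T * δ ^ 2 / 32) →
      expect μ (fun ω => ENNReal.ofReal (Real.exp (l * (Y ω - d)))) ≤ E := by
    intro l d hl hd
    calc _ = expect μ fun ω => ENNReal.ofReal (Real.exp (-(l * d))) *
          ENNReal.ofReal (Real.exp (l * Y ω)) := by
          congr 1
          ext ω
          rw [← ENNReal.ofReal_mul (by positivity), ← Real.exp_add]
          ring_nf
      _ ≤ ENNReal.ofReal (Real.exp (-(l * d))) *
          ENNReal.ofReal (Real.exp (T * (l * h + 8 * (l * h) ^ 2))) := by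
          rw [expect_const_mul]
          gcongr
          exact hmgf l hl
      _ ≤ E := by
          rw [← ENNReal.ofReal_mul (by positivity), ← Real.exp_add]
          refine ENNReal.ofReal_le_ofReal (Real.exp_le_exp.2 ?_)
          linarith
  have one_le : ∀ x : ℝ, 0 ≤ x → 1 ≤ ENNReal.ofReal (Real.exp x) := fun x hx => by
    rw [← ENNReal.ofReal_one]
    exact ENNReal.ofReal_le_ofReal (Real.one_le_exp hx)
  rcases Nat.eq_zero_or_pos h with rfl | hh
  · -- the moment generating function is at most `1` everywhere, so `Y` vanishes almost surely
    have hm := markov (T * δ ^ 2 / 32) 1 (by simp) (by simp)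
    calc _ ≤ expect μ fun ω => ENNReal.ofReal (Real.exp (T * δ ^ 2 / 32 * (Y ω - 1))) := by
          refine expect_mono fun ω => ?_
          by_cases hω : Y ω = 0
          · simp [hω]
          · refine (Set.indicator_le_self' (fun _ _ => zero_le) ω).trans (one_le _ ?_)
            have : (1 : ℝ) ≤ Y ω := by exact_mod_cast Nat.one_le_iff_ne_zero.2 hω
            have h2 : (0 : ℝ) ≤ Y ω - 1 := by linarith
            positivity
      _ ≤ E := hm
      _ ≤ 2 * E := by
          rw [two_mul]
          exact le_self_add
  · have hh' : (0 : ℝ) < h := by exact_mod_cast hh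
    -- the optimal argument of the moment generating function
    set l := δ / (16 * h) with hl
    have hlh : l * h = δ / 16 := by rw [hl]; field_simp
    have hlpos : 0 < l := by positivity
    have hlh' : |l| * h ≤ 1 / 8 := by rw [abs_of_pos hlpos, hlh]; linarith
    have h1 := markov l ((1 + δ) * (T * h)) hlh' (by
      rw [show l * ((1 + δ) * (T * h)) = (1 + δ) * T * (l * h) by ring, hlh]
      apply le_of_eq; ring)
    have h2 := markov (-l) ((1 - δ) * (T * h)) (by rwa [abs_neg]) (by
      rw [show -l * ((1 - δ) * (T * h)) = -((1 - δ) * T * (l * h)) by ring,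
        show -l * h = -(l * h) by ring, hlh]
      apply le_of_eq; ring)
    calc _ ≤ expect μ fun ω => ENNReal.ofReal (Real.exp (l * (Y ω - (1 + δ) * (T * h)))) +
          ENNReal.ofReal (Real.exp (-l * (Y ω - (1 - δ) * (T * h)))) := by
          refine expect_mono fun ω => ?_
          by_cases hω : δ * (T * h) < |(Y ω : ℝ) - T * h|
          swap
          · simp [hω]
          refine (Set.indicator_le_self' (fun _ _ => zero_le) ω).trans ?_
          rcases lt_abs.1 hω with h3 | h3
          · refine le_add_right (one_le _ (mul_nonneg hlpos.le ?_))
            linarith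
          · refine le_add_left (one_le _ ?_)
            nlinarith
      _ ≤ E + E := by
          rw [expect_add]
          exact add_le_add h1 h2
      _ = 2 * E := (two_mul E).symm

/-- Rounding `n / (2T)` to the nearest integer at most doubles the error. -/
theorem abs_round_sub_le {T n C : ℕ} (hT : 0 < T) {η : ℝ} (h : |(n : ℝ) - 2 * T * C| ≤ 2 * T * η) :
    |(((n + T) / (2 * T) : ℕ) : ℝ) - C| ≤ 2 * η := by
  set o := (n + T) / (2 * T)
  have hT' : (0 : ℝ) < T := by exact_mod_cast hT
  have h1 : 2 * T * o ≤ n + T := Nat.mul_div_le _ _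
  have h2 : n + T < 2 * T * (o + 1) := Nat.lt_mul_div_succ _ (by omega)
  have h1' : (2 * T * o : ℝ) ≤ n + T := by exact_mod_cast h1
  have h2' : (n + T : ℝ) < 2 * T * (o + 1) := by exact_mod_cast h2
  obtain ⟨h3, h4⟩ := abs_le.1 h
  by_cases hη : η < 1 / 2
  · have h5 : (o : ℝ) < C + 1 := by
      by_contra! h6
      nlinarith
    have h6 : (C : ℝ) < o + 1 := by
      by_contra! h6
      nlinarith
    have h7 : o = C := by
      have h8 : o < C + 1 := by exact_mod_cast h5
      have h9 : C < o + 1 := by exact_mod_cast h6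
      omega
    have : 0 ≤ η := by
      by_contra! h8
      nlinarith
    rw [h7]
    simpa using this
  · push Not at hη
    have h5 : (o : ℝ) - C ≤ 1 / 2 + η := by
      by_contra! h6
      nlinarith
    have h6 : (C : ℝ) - o ≤ 1 / 2 + η := by
      by_contra! h6
      nlinarith
    rw [abs_le]
    constructor <;> linarith

/-- The entry that is computed from the sums `f`, `g` of a row and of a column of length `q` and
from the accumulators `a₁` and `a₂` after `T` rounds. -/
def estimate (q T f g a₁ a₂ : ℕ) : ℕ :=
  ((if a₂ < a₁ then (f + g) * T + a₂ - q * T else (f + g) * T - a₁) + T) / (2 * T)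

/-- Truncation at `0` does not increase the distance to a non-negative number. -/
theorem abs_truncSub_sub_le {a b : ℕ} {x y : ℝ} (hx : 0 ≤ x) (h : |(a : ℝ) - b - x| ≤ y) :
    |((a - b : ℕ) : ℝ) - x| ≤ y := by
  rcases le_total b a with hab | hab
  · rwa [Nat.cast_sub hab]
  · have : (a : ℝ) ≤ b := by exact_mod_cast hab
    rw [Nat.sub_eq_zero_of_le hab, Nat.cast_zero, zero_sub, abs_neg, abs_of_nonneg hx]
    linarith [(abs_le.1 h).1]

/-- If both accumulators have relative error at most `1 / (3 m)`, then the estimate is accurate with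
respect to the smaller one of `h` and `q - h`: the comparison of the accumulators may pick the larger
one, but only if they differ at most by a factor `3`. -/
theorem abs_estimate_sub_le {q T f g a₁ a₂ h C : ℕ} {m : ℝ} (hT : 0 < T) (hm : 1 ≤ m)
    (hq : h ≤ q) (hC : 2 * C + h = f + g)
    (h₁ : |(a₁ : ℝ) - T * h| ≤ 1 / (3 * m) * (T * h))
    (h₂ : |(a₂ : ℝ) - T * (q - h : ℕ)| ≤ 1 / (3 * m) * (T * (q - h : ℕ))) :
    |(estimate q T f g a₁ a₂ : ℝ) - C| ≤ min (h : ℝ) (q - h) / m := by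
  have hT' : (0 : ℝ) < T := by exact_mod_cast hT
  have hC' : (2 * C + h : ℝ) = f + g := by exact_mod_cast hC
  rw [Nat.cast_sub hq] at h₂
  have hq' : (h : ℝ) ≤ q := by exact_mod_cast hq
  have hh : (0 : ℝ) ≤ h := by positivity
  set δ := 1 / (3 * m) with hδ
  have hδ0 : 0 < δ := by positivity
  have hδ1 : δ ≤ 1 / 3 := by
    rw [hδ]
    apply one_div_le_one_div_of_le <;> linarith
  have hmin : min (h : ℝ) (q - h) / m = 3 * δ * min (h : ℝ) (q - h) := by
    rw [hδ]; field_simp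
  rw [hmin]
  obtain ⟨h₁l, h₁u⟩ := abs_le.1 h₁
  obtain ⟨h₂l, h₂u⟩ := abs_le.1 h₂
  unfold estimate
  split_ifs with hlt
  · have hlt' : (a₂ : ℝ) ≤ a₁ := by exact_mod_cast hlt.le
    have hcmp : (q - h : ℝ) ≤ 3 * min (h : ℝ) (q - h) := by
      rcases min_choice (h : ℝ) (q - h) with h0 | h0 <;> rw [h0]
      · have : (T : ℝ) * ((1 - δ) * (q - h)) ≤ T * ((1 + δ) * h) := by nlinarith
        have := le_of_mul_le_mul_left this hT'
        nlinarith
      · linarith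
    refine (abs_round_sub_le hT (η := δ * (q - h) / 2) (abs_truncSub_sub_le (by positivity) ?_)).trans
      (by nlinarith)
    push_cast
    rw [← hC', show ((2 * C + h : ℝ)) * T + a₂ - q * T - 2 * T * C = a₂ - T * (q - h) by ring]
    linarith
  · have hlt' : (a₁ : ℝ) ≤ a₂ := by exact_mod_cast not_lt.1 hlt
    have hcmp : (h : ℝ) ≤ 3 * min (h : ℝ) (q - h) := by
      rcases min_choice (h : ℝ) (q - h) with h0 | h0 <;> rw [h0]
      · linarith
      · have : (T : ℝ) * ((1 - δ) * h) ≤ T * ((1 + δ) * (q - h)) := by nlinarith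
        have := le_of_mul_le_mul_left this hT'
        nlinarith
    refine (abs_round_sub_le hT (η := δ * h / 2) (abs_truncSub_sub_le (by positivity) ?_)).trans
      (by nlinarith)
    push_cast
    rw [← hC', show ((2 * C + h : ℝ)) * T - a₁ - 2 * T * C = -(a₁ - T * h) by ring, abs_neg]
    linarith

/-! ### The treatment of a pair, and the memory layout -/

/-- Add the squares of the difference of the two distances, and of their sum minus `q`, to the two
accumulators of a pair. -/
def updateBody : Prog :=
  block [.arith .sub 25 22 24, .arith .sub 26 24 22, .arith .add 25 25 26, .arith .mul 25 25 25,
    .arith .add 26 5 21, .load 27 26, .arith .add 27 27 25, .store 26 27,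
    .arith .add 25 22 24, .arith .sub 27 25 1, .arith .sub 28 1 25, .arith .add 27 27 28,
    .arith .mul 27 27 27, .arith .add 26 6 21, .load 28 26, .arith .add 28 28 27, .store 26 28]

/-- Replace the first accumulator of a pair by the estimate of the entry of the product. The cells of
the first accumulators are the output cells. -/
def finalBody : Prog :=
  block [.arith .add 25 22 24, .arith .mul 25 25 10, .arith .add 26 5 21, .load 27 26,
    .arith .add 28 6 21, .load 28 28,
    .ifLt 28 27 (block [.arith .add 25 25 28, .arith .mul 29 1 10, .arith .sub 25 25 29])
      (.arith .sub 25 25 27),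
    .arith .add 25 25 10, .arith .add 29 10 10, .arith .div 25 25 29, .store 26 25]

/-- The contents of the parameter registers, and of the memory cells that hold the rows `a i` of the
first matrix and the columns `b j` of the second one. Behind the input of `N = pq + qr` cells lie
two families of `pr` accumulators, a string of length `q`, and `p` and `r` cells for its distances
to the rows and to the columns. Register `16` is never written to and supplies the constant `0`. -/
structure Layout (p q r T : ℕ) (a b : ℕ → ℕ → ℕ) (s : State) : Prop where
  reg0 : s.reg 0 = p
  reg1 : s.reg 1 = q
  reg2 : s.reg 2 = r
  reg3 : s.reg 3 = 1
  reg4 : s.reg 4 = p * q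
  reg5 : s.reg 5 = p * q + q * r
  reg6 : s.reg 6 = p * q + q * r + p * r
  reg7 : s.reg 7 = p * q + q * r + p * r + p * r
  reg8 : s.reg 8 = p * q + q * r + p * r + p * r + q
  reg9 : s.reg 9 = p * q + q * r + p * r + p * r + q + p
  reg10 : s.reg 10 = T
  reg11 : s.reg 11 = 2
  reg16 : s.reg 16 = 0
  memA : ∀ i < p, ∀ k < q, s.mem (i * q + k) = a i k
  memB : ∀ j < r, ∀ k < q, s.mem (p * q + j + k * r) = b j k

theorem add_mul_lt {n x y z : ℕ} (hx : x < n) (hy : y < z) : x * z + y < n * z := by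
  have := Nat.mul_le_mul_right z (show x + 1 ≤ n from hx)
  rw [Nat.add_mul] at this
  omega

theorem Layout.of_same {p q r T : ℕ} {a b : ℕ → ℕ → ℕ} {s t : State} (h : Layout p q r T a b s)
    (hp : SameParams s t) (hm : ∀ x < p * q + q * r, t.mem x = s.mem x) :
    Layout p q r T a b t where
  reg0 := (hp 0 (by norm_num)).trans h.reg0
  reg1 := (hp 1 (by norm_num)).trans h.reg1
  reg2 := (hp 2 (by norm_num)).trans h.reg2
  reg3 := (hp 3 (by norm_num)).trans h.reg3
  reg4 := (hp 4 (by norm_num)).trans h.reg4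
  reg5 := (hp 5 (by norm_num)).trans h.reg5
  reg6 := (hp 6 (by norm_num)).trans h.reg6
  reg7 := (hp 7 (by norm_num)).trans h.reg7
  reg8 := (hp 8 (by norm_num)).trans h.reg8
  reg9 := (hp 9 (by norm_num)).trans h.reg9
  reg10 := (hp 10 (by norm_num)).trans h.reg10
  reg11 := (hp 11 (by norm_num)).trans h.reg11
  reg16 := (hp 16 (by norm_num)).trans h.reg16
  memA i hi k hk := by
    have := add_mul_lt hi hk
    rw [hm _ (by omega), h.memA i hi k hk]
  memB j hj k hk := by
    have := add_mul_lt hk hj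
    rw [hm _ (by omega), h.memB j hj k hk]

theorem updateBody_spec {w : ℕ} {ε : ℝ} {s : State} {e q O O' f g x₁ x₂ : ℕ} (h1 : s.reg 1 = q)
    (h5 : s.reg 5 = O) (h6 : s.reg 6 = O') (h21 : s.reg 21 = e) (h22 : s.reg 22 = f)
    (h24 : s.reg 24 = g) (hm₁ : s.mem (O + e) = x₁) (hm₂ : s.mem (O' + e) = x₂) (hne : O < O')
    (hf : f ≤ q) (hg : g ≤ q) (hw : O' + e < 2 ^ w) (hq : 2 * q < 2 ^ w)
    (hx₁ : x₁ + q ^ 2 < 2 ^ w) (hx₂ : x₂ + q ^ 2 < 2 ^ w) :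
    Ensures (updateBody.run w ε s) fun t => SameParams s t ∧
      (∀ x, 20 ≤ x → x < 25 → t.reg x = s.reg x) ∧ t.mem (O + e) = x₁ + Nat.dist f g ^ 2 ∧
      t.mem (O' + e) = x₂ + Nat.dist (f + g) q ^ 2 ∧
      (∀ a, a ≠ O + e → a ≠ O' + e → t.mem a = s.mem a) ∧ t.time ≤ s.time + 25 := by
  have d1 : f - g + (g - f) = Nat.dist f g := rfl
  have d2 : f + g - q + (q - (f + g)) = Nat.dist (f + g) q := rfl
  have b1 : Nat.dist f g ≤ q := by rw [← d1]; omega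
  have b2 : Nat.dist (f + g) q ≤ q := by rw [← d2]; omega
  have c1 : Nat.dist f g ^ 2 ≤ q ^ 2 := Nat.pow_le_pow_left b1 2
  have c2 : Nat.dist (f + g) q ^ 2 ≤ q ^ 2 := Nat.pow_le_pow_left b2 2
  have e1 : (Nat.dist f g) % 2 ^ w = Nat.dist f g := Nat.mod_eq_of_lt (by omega)
  have e2 : Nat.dist f g * Nat.dist f g % 2 ^ w = Nat.dist f g ^ 2 := by
    rw [← sq]; exact Nat.mod_eq_of_lt (by omega)
  have e3 : (O + e) % 2 ^ w = O + e := Nat.mod_eq_of_lt (by omega)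
  have e4 : (x₁ + Nat.dist f g ^ 2) % 2 ^ w = x₁ + Nat.dist f g ^ 2 := Nat.mod_eq_of_lt (by omega)
  have e5 : (f + g) % 2 ^ w = f + g := Nat.mod_eq_of_lt (by omega)
  have e6 : (Nat.dist (f + g) q) % 2 ^ w = Nat.dist (f + g) q := Nat.mod_eq_of_lt (by omega)
  have e7 : Nat.dist (f + g) q * Nat.dist (f + g) q % 2 ^ w = Nat.dist (f + g) q ^ 2 := by
    rw [← sq]; exact Nat.mod_eq_of_lt (by omega)
  have e8 : (O' + e) % 2 ^ w = O' + e := Nat.mod_eq_of_lt hw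
  have e9 : (x₂ + Nat.dist (f + g) q ^ 2) % 2 ^ w = x₂ + Nat.dist (f + g) q ^ 2 :=
    Nat.mod_eq_of_lt (by omega)
  have n1 : O' ≠ O := by omega
  simp [updateBody, ↓ensures_block_cons, ↓ensures_block_nil, ↓ensures_arith, ↓ensures_load,
    ↓ensures_store, State.tick, State.setReg, State.setMem, Op.eval, h1, h5, h6, h21, h22, h24, hm₁,
    d1, d2, e1, e2, e3, e4, e5, e6, e7, e8, e9, n1, n1.symm, hm₂]
  refine ⟨fun x hx => ?_, fun x hx hx' => ?_, fun a ha ha' => ?_⟩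
  · simp [update_scratch, hx]
  · simp only [Function.update_of_ne (show x ≠ 25 by omega),
      Function.update_of_ne (show x ≠ 26 by omega), Function.update_of_ne (show x ≠ 27 by omega),
      Function.update_of_ne (show x ≠ 28 by omega)]
  · simp [ha, ha']

theorem finalBody_spec {w : ℕ} {ε : ℝ} {s : State} {e q T O O' f g x₁ x₂ : ℕ} (h1 : s.reg 1 = q)
    (h5 : s.reg 5 = O) (h6 : s.reg 6 = O') (h10 : s.reg 10 = T) (h21 : s.reg 21 = e)
    (h22 : s.reg 22 = f) (h24 : s.reg 24 = g) (hm₁ : s.mem (O + e) = x₁)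
    (hm₂ : s.mem (O' + e) = x₂) (hne : O < O') (hf : f ≤ q) (hg : g ≤ q) (hw : O' + e < 2 ^ w)
    (hq : 2 * q < 2 ^ w) (hx₂ : 2 * q * T + x₂ + 2 * T < 2 ^ w) :
    Ensures (finalBody.run w ε s) fun t => SameParams s t ∧
      (∀ x, 20 ≤ x → x < 25 → t.reg x = s.reg x) ∧ t.mem (O + e) = estimate q T f g x₁ x₂ ∧
      t.mem (O' + e) = x₂ ∧
      (∀ a, a ≠ O + e → a ≠ O' + e → t.mem a = s.mem a) ∧ t.time ≤ s.time + 25 := by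
  have c1 : (f + g) * T ≤ 2 * q * T := Nat.mul_le_mul_right _ (by omega)
  have c2 : q * T ≤ 2 * q * T := Nat.mul_le_mul_right _ (by omega)
  have e1 : (f + g) % 2 ^ w = f + g := Nat.mod_eq_of_lt (by omega)
  have e2 : (f + g) * T % 2 ^ w = (f + g) * T := Nat.mod_eq_of_lt (by omega)
  have e3 : (O + e) % 2 ^ w = O + e := Nat.mod_eq_of_lt (by omega)
  have e4 : (O' + e) % 2 ^ w = O' + e := Nat.mod_eq_of_lt hw
  have e5 : ((f + g) * T + x₂) % 2 ^ w = (f + g) * T + x₂ := Nat.mod_eq_of_lt (by omega)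
  have e6 : q * T % 2 ^ w = q * T := Nat.mod_eq_of_lt (by omega)
  have e7 : ((f + g) * T + x₂ - q * T + T) % 2 ^ w = (f + g) * T + x₂ - q * T + T :=
    Nat.mod_eq_of_lt (by omega)
  have e8 : ((f + g) * T - x₁ + T) % 2 ^ w = (f + g) * T - x₁ + T := Nat.mod_eq_of_lt (by omega)
  have e9 : (T + T) % 2 ^ w = 2 * T := by rw [← two_mul]; exact Nat.mod_eq_of_lt (by omega)
  have n1 : O' ≠ O := by omega
  by_cases hlt : x₂ < x₁
  · simp [finalBody, ↓ensures_block_cons, ↓ensures_block_nil, ↓ensures_arith, ↓ensures_load,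
      ↓ensures_store, ↓ensures_ifLt, State.tick, State.setReg, State.setMem, Op.eval, h1, h5, h6,
      h10, h21, h22, h24, hm₁, e1, e2, e3, e4, e5, e6, e7, e9, n1, hm₂, hlt, estimate]
    refine ⟨fun x hx => ?_, fun x hx hx' => ?_, fun a ha ha' => ?_⟩
    · simp [update_scratch, hx]
    · simp only [Function.update_of_ne (show x ≠ 25 by omega),
        Function.update_of_ne (show x ≠ 26 by omega), Function.update_of_ne (show x ≠ 27 by omega),
        Function.update_of_ne (show x ≠ 28 by omega), Function.update_of_ne (show x ≠ 29 by omega)]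
    · simp [ha]
  · simp [finalBody, ↓ensures_block_cons, ↓ensures_block_nil, ↓ensures_arith, ↓ensures_load,
      ↓ensures_store, ↓ensures_ifLt, State.tick, State.setReg, State.setMem, Op.eval, h5, h6,
      h10, h21, h22, h24, hm₁, e1, e2, e3, e4, e8, e9, n1, hm₂, hlt, estimate]
    refine ⟨fun x hx => ?_, fun x hx hx' => ?_, fun a ha ha' => ?_⟩
    · simp [update_scratch, hx]
    · simp only [Function.update_of_ne (show x ≠ 25 by omega),
        Function.update_of_ne (show x ≠ 26 by omega), Function.update_of_ne (show x ≠ 27 by omega),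
        Function.update_of_ne (show x ≠ 28 by omega), Function.update_of_ne (show x ≠ 29 by omega)]
    · simp [ha]

/-- Compute the distances of the current string to all rows and columns, and then treat all pairs. -/
def sketchAndTreat (body : Prog) : Prog :=
  block [sketch 0 16 1 3 8, sketch 2 4 3 2 9, forPairs body]

theorem sketchAndTreat_spec {w : ℕ} {ε : ℝ} {body : Prog} {s : State} {p q r T : ℕ}
    {a b : ℕ → ℕ → ℕ} (hs : Layout p q r T a b s)
    (ha : ∀ i < p, ∀ k < q, a i k ≤ 1) (hb : ∀ j < r, ∀ k < q, b j k ≤ 1) {σ : ℕ → ℕ}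
    (hσ : ∀ k < q, s.mem (p * q + q * r + p * r + p * r + k) = σ k ∧ σ k ≤ 1)
    (hw : p * q + q * r + p * r + p * r + q + p + r < 2 ^ w) {v₁ v₂ : ℕ → ℕ}
    (hbody : ∀ t, ∀ e < p * r, SameParams s t → t.reg 21 = e →
      t.reg 22 = distTo q (a (e / r)) σ → t.reg 24 = distTo q (b (e % r)) σ →
      t.mem (p * q + q * r + e) = s.mem (p * q + q * r + e) →
      t.mem (p * q + q * r + p * r + e) = s.mem (p * q + q * r + p * r + e) →
      Ensures (body.run w ε t) fun t' => SameParams s t' ∧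
        (∀ x, 20 ≤ x → x < 25 → t'.reg x = t.reg x) ∧ t'.mem (p * q + q * r + e) = v₁ e ∧
        t'.mem (p * q + q * r + p * r + e) = v₂ e ∧
        (∀ a, a ≠ p * q + q * r + e → a ≠ p * q + q * r + p * r + e → t'.mem a = t.mem a) ∧
        t'.time ≤ t.time + 25) :
    Ensures ((sketchAndTreat body).run w ε s) fun t => Layout p q r T a b t ∧
      (∀ e < p * r, t.mem (p * q + q * r + e) = v₁ e ∧
        t.mem (p * q + q * r + p * r + e) = v₂ e) ∧
      t.time ≤ s.time + (p * (11 * q + 10) + r * (11 * q + 10) + p * (31 * r + 7) + 11) := by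
  unfold sketchAndTreat
  set N := p * q + q * r with hN
  set S := N + p * r + p * r with hS
  have hA : ∀ x < p, ∀ k < q, x * q + k < p * q := fun x hx k hk => add_mul_lt hx hk
  have hB : ∀ x < r, ∀ k < q, k * r + x < q * r := fun x hx k hk => add_mul_lt hk hx
  rw [ensures_block_cons]
  refine (sketch_spec (by norm_num) (by norm_num) (by norm_num) (by norm_num) (by norm_num)
    hs.reg0 hs.reg16 hs.reg1 hs.reg3 hs.reg8 hs.reg1 hs.reg3 hs.reg7 (M := a) (σ := σ)
    (fun x hx k hk => ?_) (fun x hx k hk => ?_) hσ le_rfl (by omega) (by omega)).mono ?_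
  · rw [zero_add, mul_one]
    exact ⟨hs.memA x hx k hk, ha x hx k hk⟩
  · have := hA x hx k hk
    rw [zero_add, mul_one]
    omega
  rintro s₁ ⟨p1, f1, m1, t1⟩
  have hs₁ : Layout p q r T a b s₁ := hs.of_same p1 fun x hx => m1 x (by omega)
  rw [ensures_block_cons]
  refine (sketch_spec (by norm_num) (by norm_num) (by norm_num) (by norm_num) (by norm_num)
    hs₁.reg2 hs₁.reg4 hs₁.reg3 hs₁.reg2 hs₁.reg9 hs₁.reg1 hs₁.reg3 hs₁.reg7 (M := b) (σ := σ)
    (fun x hx k hk => ?_) (fun x hx k hk => ?_) (fun k hk => ?_) (by omega) (by omega)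
    (by omega)).mono ?_
  · rw [mul_one]
    exact ⟨hs₁.memB x hx k hk, hb x hx k hk⟩
  · have := hB x hx k hk
    omega
  · rw [m1 _ (by omega)]
    exact hσ k hk
  rintro s₂ ⟨p2, f2, m2, t2⟩
  have hs₂ : Layout p q r T a b s₂ := hs₁.of_same p2 fun x hx => m2 x (by omega)
  rw [ensures_block_cons]
  refine (forPairs_spec (O := N) (S := S) hs₂.reg0 hs₂.reg2 hs₂.reg3 hs₂.reg8 hs₂.reg9 rfl
    (by omega) le_rfl (by omega) (F := fun i => distTo q (a i) σ) (G := fun j => distTo q (b j) σ)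
    (fun i hi => ?_) f2 (v₁ := v₁) (v₂ := v₂) ?_).mono ?_
  · rw [m2 _ (by omega), f1 i hi]
  · intro t e he hp h21 h22 h24 h1 h2
    refine (hbody t e he (p1.trans (p2.trans hp)) h21 h22 h24 ?_ ?_).mono ?_
    · rw [h1, m2 _ (by omega), m1 _ (by omega)]
    · rw [h2, m2 _ (by omega), m1 _ (by omega)]
    · rintro t' ⟨k1, k2⟩
      exact ⟨fun x hx => by rw [k1 x hx, p2 x hx, p1 x hx], k2⟩
  rintro s₃ ⟨p3, f3, m3, t3⟩
  rw [ensures_block_nil]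
  refine ⟨hs₂.of_same p3 fun x hx => m3 x (by omega), f3, ?_⟩
  simp only [State.tick]
  omega

/-! ### The rounds and the preparation of the registers -/

/-- The increment of the first accumulator of the pair with index `e`. -/
def incDiff (q r : ℕ) (a b : ℕ → ℕ → ℕ) (σ : ℕ → ℕ) (e : ℕ) : ℕ :=
  Nat.dist (distTo q (a (e / r)) σ) (distTo q (b (e % r)) σ) ^ 2

/-- The increment of the second accumulator of the pair with index `e`. -/
def incSum (q r : ℕ) (a b : ℕ → ℕ → ℕ) (σ : ℕ → ℕ) (e : ℕ) : ℕ :=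
  Nat.dist (distTo q (a (e / r)) σ + distTo q (b (e % r)) σ) q ^ 2

theorem incDiff_le {q r : ℕ} {a b : ℕ → ℕ → ℕ} {σ : ℕ → ℕ} {e : ℕ}
    (hf : distTo q (a (e / r)) σ ≤ q) (hg : distTo q (b (e % r)) σ ≤ q) :
    incDiff q r a b σ e ≤ q ^ 2 := by
  refine Nat.pow_le_pow_left ?_ 2
  unfold Nat.dist
  omega

theorem incSum_le {q r : ℕ} {a b : ℕ → ℕ → ℕ} {σ : ℕ → ℕ} {e : ℕ}
    (hf : distTo q (a (e / r)) σ ≤ q) (hg : distTo q (b (e % r)) σ ≤ q) :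
    incSum q r a b σ e ≤ q ^ 2 := by
  refine Nat.pow_le_pow_left ?_ 2
  unfold Nat.dist
  omega

/-- One round: a random bit string, its distances, and the update of all accumulators. -/
def roundProg : Prog := (fill 11).seq (sketchAndTreat updateBody)

/-- All rounds, and the computation of the output from the accumulators and from the row and column
sums, which are the distances to the zero string. As register `3` holds `1`, `fill 3` draws random
numbers below `1`, that is, zeros. -/
def mainProg : Prog :=
  (Prog.loop 10 roundProg).seq ((fill 3).seq (sketchAndTreat finalBody))

/-- After `n` rounds, started at time `t₀`, the machine state holds the abstract accumulators `ω`. The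
bounds on `ω` exclude an overflow. -/
structure Holds (p q r T : ℕ) (a b : ℕ → ℕ → ℕ) (t₀ n : ℕ) (ω : (ℕ → ℕ) × (ℕ → ℕ)) (s : State) :
    Prop where
  layout : Layout p q r T a b s
  acc₁ : ∀ e < p * r, s.mem (p * q + q * r + e) = ω.1 e ∧ ω.1 e ≤ n * q ^ 2
  acc₂ : ∀ e < p * r, s.mem (p * q + q * r + p * r + e) = ω.2 e ∧ ω.2 e ≤ n * q ^ 2
  time : s.time ≤ t₀ + n * (100 * (p * q + q * r + p * r))

/-- The index `e = i * r + j` of a pair determines `i` and `j`. -/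
theorem div_lt_and_mod_lt {e p r : ℕ} (he : e < p * r) : e / r < p ∧ e % r < r := by
  have hr : 0 < r := Nat.pos_of_ne_zero fun h => by simp [h] at he
  exact ⟨Nat.div_lt_of_lt_mul (by rwa [mul_comm] at he), Nat.mod_lt _ hr⟩

theorem round_time_le {p q r : ℕ} (hp : 1 ≤ p) (hq : 1 ≤ q) (hr : 1 ≤ r) :
    6 * q + 3 + (p * (11 * q + 10) + r * (11 * q + 10) + p * (31 * r + 7) + 11) + 1 ≤
      100 * (p * q + q * r + p * r) := by
  have h1 := Nat.mul_le_mul_left p hq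
  have h2 := Nat.mul_le_mul_left q hr
  have h3 := Nat.mul_le_mul_right r hq
  have h4 := Nat.mul_le_mul hp hq
  ring_nf at *
  omega

section

variable {w : ℕ} {ε : ℝ} {p q r T : ℕ} {a b : ℕ → ℕ → ℕ} (hp : 1 ≤ p) (hq : 1 ≤ q) (hr : 1 ≤ r)
  (ha : ∀ i < p, ∀ k < q, a i k ≤ 1) (hb : ∀ j < r, ∀ k < q, b j k ≤ 1)
  (hw : p * q + q * r + p * r + p * r + q + p + r < 2 ^ w)
  (hT : 2 * q * T + T * q ^ 2 + 2 * T < 2 ^ w)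
include hp hq hr ha hb hw hT

/-- The machine performs a round of the abstract random process. -/
theorem sim_roundProg {t₀ n : ℕ} (hn : n < T) {ω : (ℕ → ℕ) × (ℕ → ℕ)} {s : State}
    (hs : Holds p q r T a b t₀ n ω s) :
    Sim (roundStep q (incDiff q r a b) (incSum q r a b) ω) (roundProg.run w ε s.tick)
      (Holds p q r T a b t₀ (n + 1)) := by
  have hL := hs.layout
  have hqr := Nat.mul_le_mul_left q hr
  have hnT : (n + 1) * q ^ 2 ≤ T * q ^ 2 := Nat.mul_le_mul_right _ hn
  have hstep : (n + 1) * q ^ 2 = n * q ^ 2 + q ^ 2 := by ring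
  refine Sim.map ?_
  have hfill := fill_spec (w := w) (ε := ε) (y := 11) (by norm_num) (s := s.tick) (q := q)
    (S := p * q + q * r + p * r + p * r) hL.reg1 hL.reg3 hL.reg7 (by omega) fun _ => 0
  rw [show s.tick.reg 11 = 2 from hL.reg11] at hfill
  refine hfill.bind_right ?_
  rintro ⟨k, σ⟩ t ⟨h1, h2, h3, h4⟩
  have ht : Layout p q r T a b t := hL.of_same h1 fun x hx => h3 x (by omega)
  have hσ : ∀ k < q, σ k ≤ 1 := fun k hk => by
    have : σ k < 2 - 1 + 1 := (h2 k hk).2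
    omega
  have hFG : ∀ e < p * r, distTo q (a (e / r)) σ ≤ q ∧ distTo q (b (e % r)) σ ≤ q := fun e he =>
    ⟨distTo_le (ha _ (div_lt_and_mod_lt he).1) hσ, distTo_le (hb _ (div_lt_and_mod_lt he).2) hσ⟩
  refine (sketchAndTreat_spec ht ha hb (fun k hk => ⟨(h2 k hk).1, hσ k hk⟩) hw
    (v₁ := fun e => ω.1 e + incDiff q r a b σ e) (v₂ := fun e => ω.2 e + incSum q r a b σ e)
    ?_).mono ?_
  · intro u e he hu h21 h22 h24 m1 m2
    rw [h3 _ (by omega)] at m1 m2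
    have b1 := hs.acc₁ e he
    have b2 := hs.acc₂ e he
    have hpr : 0 < p * r := by omega
    refine (updateBody_spec ((hu 1 (by norm_num)).trans ht.reg1) ((hu 5 (by norm_num)).trans ht.reg5)
      ((hu 6 (by norm_num)).trans ht.reg6) h21 h22 h24 (m1.trans b1.1) (m2.trans b2.1) (by omega)
      (hFG e he).1 (hFG e he).2 (by omega) (by omega) (by omega) (by omega)).mono ?_
    rintro u' ⟨k1, k2⟩
    exact ⟨hu.trans k1, k2⟩
  · rintro u ⟨k1, k2, k3⟩
    refine ⟨k1, fun e he => ⟨(k2 e he).1, ?_⟩, fun e he => ⟨(k2 e he).2, ?_⟩, ?_⟩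
    · have := (hs.acc₁ e he).2
      have := incDiff_le (hFG e he).1 (hFG e he).2
      simp only
      omega
    · have := (hs.acc₂ e he).2
      have := incSum_le (hFG e he).1 (hFG e he).2
      simp only
      omega
    · have h5 := hs.time
      have h6 := round_time_le hp hq hr
      simp only [State.tick] at h4
      rw [Nat.add_mul, one_mul]
      omega

/-- The outputs are the estimates computed from accumulators with the distribution of the abstract
process after `T` rounds. -/
theorem sim_mainProg {s : State} (hs : Layout p q r T a b s)
    (hm : ∀ e, p * q + q * r ≤ e → s.mem e = 0) :
    Sim (iterM (roundStep q (incDiff q r a b) (incSum q r a b)) T (fun _ => 0, fun _ => 0))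
      (mainProg.run w ε s) fun ω t =>
        (∀ e < p * r, t.mem (p * q + q * r + e) =
          estimate q T (distTo q (a (e / r)) fun _ => 0) (distTo q (b (e % r)) fun _ => 0)
            (ω.1 e) (ω.2 e)) ∧
        t.time ≤ s.time + (T + 2) * (100 * (p * q + q * r + p * r)) := by
  have hqr := Nat.mul_le_mul_left q hr
  have hloop : Sim (iterM (roundStep q (incDiff q r a b) (incSum q r a b)) T
      (fun _ => 0, fun _ => 0)) ((Prog.loop 10 roundProg).run w ε s)
      (Holds p q r T a b (s.time + 1) T) := by
    rw [Prog.run, hs.reg10]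
    refine Sim.iter (R := Holds p q r T a b (s.time + 1)) (fun k hk ω t ht =>
      sim_roundProg hp hq hr ha hb hw hT hk ht) ?_
    refine ⟨⟨hs.1, hs.2, hs.3, hs.4, hs.5, hs.6, hs.7, hs.8, hs.9, hs.10, hs.11, hs.12, hs.13,
      hs.14, hs.15⟩, fun e he => ?_, fun e he => ?_, ?_⟩
    · simpa [State.tick] using hm _ (by omega)
    · simpa [State.tick] using hm _ (by omega)
    · simp [State.tick]
  refine hloop.bind_right fun ω t ht => ?_
  have hL := ht.layout
  rw [ensures_seq]
  have hfill := fill_spec (w := w) (ε := ε) (y := 3) (by norm_num) (s := t) (q := q)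
    (S := p * q + q * r + p * r + p * r) hL.reg1 hL.reg3 hL.reg7 (by omega) fun _ => 0
  refine hfill.ensures.mono ?_
  rintro t' ⟨⟨k, σ⟩, h1, h2, h3, h4⟩
  rw [hL.reg3] at h2
  have ht' : Layout p q r T a b t' := hL.of_same h1 fun x hx => h3 x (by omega)
  have hσ : ∀ k < q, t'.mem (p * q + q * r + p * r + p * r + k) = (fun _ => 0) k ∧
      (fun _ => 0) k ≤ 1 := fun k hk => by
    have : σ k < 1 - 1 + 1 := (h2 k hk).2
    refine ⟨(h2 k hk).1.trans ?_, by simp⟩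
    simp only
    omega
  have hFG : ∀ e < p * r, distTo q (a (e / r)) (fun _ => 0) ≤ q ∧
      distTo q (b (e % r)) (fun _ => 0) ≤ q := fun e he =>
    ⟨distTo_le (ha _ (div_lt_and_mod_lt he).1) (by simp),
      distTo_le (hb _ (div_lt_and_mod_lt he).2) (by simp)⟩
  refine (sketchAndTreat_spec ht' ha hb hσ hw (v₁ := fun e => estimate q T
    (distTo q (a (e / r)) fun _ => 0) (distTo q (b (e % r)) fun _ => 0) (ω.1 e) (ω.2 e))
    (v₂ := ω.2) ?_).mono ?_
  · intro u e he hu h21 h22 h24 m1 m2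
    rw [h3 _ (by omega)] at m1 m2
    have b1 := ht.acc₁ e he
    have b2 := ht.acc₂ e he
    have hpr : 0 < p * r := by omega
    refine (finalBody_spec ((hu 1 (by norm_num)).trans ht'.reg1)
      ((hu 5 (by norm_num)).trans ht'.reg5) ((hu 6 (by norm_num)).trans ht'.reg6)
      ((hu 10 (by norm_num)).trans ht'.reg10) h21 h22 h24 (m1.trans b1.1) (m2.trans b2.1) (by omega)
      (hFG e he).1 (hFG e he).2 (by omega) (by omega) (by omega)).mono ?_
    rintro u' ⟨k1, k2⟩
    exact ⟨hu.trans k1, k2⟩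
  · rintro u ⟨-, k2, k3⟩
    refine ⟨fun e he => (k2 e he).1, ?_⟩
    have h5 := ht.time
    have h6 := round_time_le hp hq hr
    have h7 := Nat.mul_le_mul hp hq
    rw [Nat.add_mul]
    omega

end

/-- Load the constants and compute the addresses of the memory regions. -/
def setupRegs (K : ℕ) : Prog :=
  block [.const 3 1, .const 11 2, .const 12 1, .const 13 0, .const 14 1, .const 15 K,
    .arith .mul 4 0 1, .arith .mul 5 1 2, .arith .add 5 4 5, .arith .mul 6 0 2,
    .arith .add 7 6 6, .arith .add 6 5 6, .arith .add 7 5 7, .arith .add 8 7 1, .arith .add 9 8 0]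

/-- Compute the least `m ≥ 1` with `1 < ε * m`, or `q + 1` if that is smaller. The cap is needed since
only counted loops are available, and `q` iterations are affordable. -/
def invLoop : Prog := .loop 1 (.ifEps 12 3 (.arith .add 12 12 3) .skip)

/-- Compute the binary logarithm `L` of the input size, rounded up, by doubling register `14`. -/
def logLoop : Prog :=
  .loop 5 (.ifLt 14 5 (block [.arith .add 14 14 14, .arith .add 13 13 3]) .skip)

theorem invLoop_spec {w : ℕ} {ε : ℝ} {s : State} {q : ℕ} (h1 : s.reg 1 = q) (h3 : s.reg 3 = 1)
    (h12 : s.reg 12 = 1) (hw : q + 1 < 2 ^ w) :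
    Ensures (invLoop.run w ε s) fun t => ∃ m, t.reg 12 = m ∧ 1 ≤ m ∧ m ≤ q + 1 ∧
      (1 < ε * m ∨ m = q + 1) ∧ (m = 1 ∨ ε * (m - 1) ≤ 1) ∧ (∀ x, x ≠ 12 → t.reg x = s.reg x) ∧
      t.mem = s.mem ∧ t.time ≤ s.time + 3 * q + 1 := by
  refine ensures_loop (fun k t => ∃ m, t.reg 12 = m ∧ 1 ≤ m ∧ m ≤ k + 1 ∧
      (1 < ε * m ∨ m = k + 1) ∧ (m = 1 ∨ ε * (m - 1) ≤ 1) ∧ (∀ x, x ≠ 12 → t.reg x = s.reg x) ∧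
      t.mem = s.mem ∧ t.time ≤ s.time + 3 * k + 1) ?_ ?_ (by rw [h1]; exact fun t ht => ht)
  · exact ⟨1, h12, le_rfl, by omega, Or.inr rfl, Or.inl rfl, fun _ _ => rfl, rfl, le_rfl⟩
  rw [h1]
  rintro k hk t ⟨m, f12, hm1, hmk, hm2, hm3, hx, hmem, ht⟩
  have f3 : t.reg 3 = 1 := (hx 3 (by norm_num)).trans h3
  have j : (m + 1) % 2 ^ w = m + 1 := Nat.mod_eq_of_lt (by omega)
  rw [ensures_ifEps]
  simp only [State.tick, f12, f3, Nat.cast_one]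
  refine ⟨fun hε => ?_, fun hε => ?_⟩
  · rw [ensures_arith]
    refine ⟨m + 1, ?_, by omega, by omega, ?_, Or.inr (by simpa using hε), fun x hx' => ?_, hmem, ?_⟩
    · simp [State.tick, State.setReg, Op.eval, f12, f3, j]
    · right
      rcases hm2 with h | h
      · exact absurd hε (not_le.2 h)
      · omega
    · simp [State.tick, State.setReg, hx', hx x hx']
    · simp only [State.tick, State.setReg]
      omega
  · rw [ensures_skip]
    refine ⟨m, f12, hm1, by omega, Or.inl (not_le.1 hε), hm3, hx, hmem, ?_⟩
    simp only [State.tick]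
    omega

theorem logLoop_spec {w : ℕ} {ε : ℝ} {s : State} {N : ℕ} (hN : 1 ≤ N) (h5 : s.reg 5 = N)
    (h3 : s.reg 3 = 1) (h13 : s.reg 13 = 0) (h14 : s.reg 14 = 1) (hw : 2 * N < 2 ^ w) :
    Ensures (logLoop.run w ε s) fun t => ∃ L, t.reg 13 = L ∧ N ≤ 2 ^ L ∧ 2 ^ L < 2 * N ∧
      (∀ x, x ≠ 13 → x ≠ 14 → t.reg x = s.reg x) ∧ t.mem = s.mem ∧
      t.time ≤ s.time + 5 * N + 1 := by
  refine ensures_loop (fun k t => ∃ L, t.reg 13 = L ∧ t.reg 14 = 2 ^ L ∧ (N ≤ 2 ^ L ∨ L = k) ∧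
      2 ^ L < 2 * N ∧ (∀ x, x ≠ 13 → x ≠ 14 → t.reg x = s.reg x) ∧ t.mem = s.mem ∧
      t.time ≤ s.time + 5 * k + 1) ?_ ?_ ?_
  · exact ⟨0, h13, h14, Or.inr rfl, by omega, fun _ _ _ => rfl, rfl, le_rfl⟩
  · rw [h5]
    rintro k hk t ⟨L, f13, f14, hL, hL', hx, hmem, ht⟩
    have f3 : t.reg 3 = 1 := (hx 3 (by norm_num) (by norm_num)).trans h3
    have f5 : t.reg 5 = N := (hx 5 (by norm_num) (by norm_num)).trans h5
    have hLL : L < 2 ^ L := Nat.lt_two_pow_self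
    have j : (L + 1) % 2 ^ w = L + 1 := Nat.mod_eq_of_lt (by omega)
    rw [ensures_ifLt]
    simp only [State.tick, f14, f5]
    split_ifs with hlt
    · have j' : (2 ^ L + 2 ^ L) % 2 ^ w = 2 ^ (L + 1) := by
        rw [← two_mul, ← pow_succ']
        exact Nat.mod_eq_of_lt (by rw [pow_succ]; omega)
      simp only [↓ensures_block_cons, ↓ensures_block_nil, ↓ensures_arith]
      refine ⟨L + 1, ?_, ?_, Or.inr (by omega), by rw [pow_succ]; omega, fun x hx1 hx2 => ?_, hmem,
        ?_⟩
      · simp [State.tick, State.setReg, Op.eval, f13, f3, j]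
      · simp [State.tick, State.setReg, Op.eval, f14, j']
      · simp [State.tick, State.setReg, hx1, hx2, hx x hx1 hx2]
      · simp only [State.tick, State.setReg]
        omega
    · rw [ensures_skip]
      refine ⟨L, f13, f14, Or.inl (not_lt.1 hlt), hL', hx, hmem, ?_⟩
      simp only [State.tick]
      omega
  · rw [h5]
    rintro t ⟨L, f13, f14, hL, hL', hx, hmem, ht⟩
    refine ⟨L, f13, ?_, hL', hx, hmem, ht⟩
    rcases hL with h | rfl
    · exact h
    · exact Nat.lt_two_pow_self.le

/-- Prepare the registers; the number of rounds is `K * m ^ 2 * L` for the numbers `m` and `L`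
found by the two loops. -/
def prologue (K : ℕ) : Prog :=
  block [setupRegs K, invLoop, logLoop,
    .arith .mul 10 12 12, .arith .mul 10 10 13, .arith .mul 10 10 15]

theorem prologue_spec {w K : ℕ} {ε : ℝ} {p q r : ℕ} (hp : 1 ≤ p) (hq : 1 ≤ q) (hr : 1 ≤ r)
    {a b : ℕ → ℕ → ℕ} {s : State} (h0 : s.reg 0 = p) (h1 : s.reg 1 = q) (h2 : s.reg 2 = r)
    (h16 : s.reg 16 = 0) (hA : ∀ i < p, ∀ k < q, s.mem (i * q + k) = a i k)
    (hB : ∀ j < r, ∀ k < q, s.mem (p * q + j + k * r) = b j k)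
    (hw : p * q + q * r + p * r + p * r + q + p + r < 2 ^ w) (hwN : 2 * (p * q + q * r) < 2 ^ w)
    (hwK : (q + 1) ^ 2 * (p * q + q * r) * (K + 1) < 2 ^ w) :
    Ensures ((prologue K).run w ε s) fun t => ∃ m L, 1 ≤ m ∧ m ≤ q + 1 ∧
      (1 < ε * m ∨ m = q + 1) ∧ (m = 1 ∨ ε * (m - 1) ≤ 1) ∧ p * q + q * r ≤ 2 ^ L ∧
      2 ^ L < 2 * (p * q + q * r) ∧ Layout p q r (K * m ^ 2 * L) a b t ∧ t.mem = s.mem ∧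
      t.time ≤ s.time + 12 * (p * q + q * r) + 30 := by
  have hpq := Nat.mul_le_mul hp hq
  have hqr := Nat.mul_le_mul hq hr
  have hpr := Nat.mul_le_mul hp hr
  have hK : K < 2 ^ w := by
    refine lt_of_le_of_lt ?_ hwK
    calc K ≤ 1 * (K + 1) := by omega
      _ ≤ _ := Nat.mul_le_mul_right _ (Nat.mul_pos (by positivity) (by omega))
  set N := p * q + q * r with hN
  unfold prologue
  rw [ensures_block_cons]
  refine Ensures.mono (Q := fun t => (t.reg 0 = p ∧ t.reg 1 = q ∧ t.reg 2 = r ∧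
    t.reg 3 = 1 ∧ t.reg 4 = p * q ∧ t.reg 5 = N ∧ t.reg 6 = N + p * r ∧
    t.reg 7 = N + p * r + p * r ∧ t.reg 8 = N + p * r + p * r + q ∧
    t.reg 9 = N + p * r + p * r + q + p ∧ t.reg 11 = 2 ∧ t.reg 15 = K ∧ t.reg 16 = 0 ∧
    t.reg 12 = 1 ∧ t.reg 13 = 0 ∧ t.reg 14 = 1) ∧ t.mem = s.mem ∧ t.time ≤ s.time + 16) ?_ ?_
  · have i1 : 1 % 2 ^ w = 1 := Nat.mod_eq_of_lt (by omega)
    have i2 : 2 % 2 ^ w = 2 := Nat.mod_eq_of_lt (by omega)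
    have iK : K % 2 ^ w = K := Nat.mod_eq_of_lt hK
    have j1 : p * q % 2 ^ w = p * q := Nat.mod_eq_of_lt (by omega)
    have j2 : q * r % 2 ^ w = q * r := Nat.mod_eq_of_lt (by omega)
    have j3 : (p * q + q * r) % 2 ^ w = N := Nat.mod_eq_of_lt (by omega)
    have j4 : p * r % 2 ^ w = p * r := Nat.mod_eq_of_lt (by omega)
    have j5 : (p * r + p * r) % 2 ^ w = p * r + p * r := Nat.mod_eq_of_lt (by omega)
    have j6 : (N + p * r) % 2 ^ w = N + p * r := Nat.mod_eq_of_lt (by omega)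
    have j7 : (N + (p * r + p * r)) % 2 ^ w = N + p * r + p * r := by
      rw [← add_assoc]
      exact Nat.mod_eq_of_lt (by omega)
    have j8 : (N + p * r + p * r + q) % 2 ^ w = N + p * r + p * r + q :=
      Nat.mod_eq_of_lt (by omega)
    have j9 : (N + p * r + p * r + q + p) % 2 ^ w = N + p * r + p * r + q + p :=
      Nat.mod_eq_of_lt (by omega)
    unfold setupRegs
    simp only [↓ensures_block_cons, ↓ensures_const, ↓ensures_arith, ↓ensures_block_nil]
    simp [State.tick, State.setReg, Op.eval, h0, h1, h2, h16, i1, i2, iK, j1, j2, j3, j4, j5, j6, j7,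
      j8, j9]
  rintro s₁ ⟨⟨f0, f1, f2, f3, f4, f5, f6, f7, f8, f9, f11, f15, f16, f12, f13, f14⟩, fm, ft⟩
  rw [ensures_block_cons]
  refine (invLoop_spec f1 f3 f12 (by omega)).mono ?_
  rintro s₂ ⟨m, g12, hm1, hmk, hm2, hm3, gx, gm, gt⟩
  rw [ensures_block_cons]
  refine (logLoop_spec (N := N) (by omega) ((gx 5 (by norm_num)).trans f5)
    ((gx 3 (by norm_num)).trans f3) ((gx 13 (by norm_num)).trans f13)
    ((gx 14 (by norm_num)).trans f14) hwN).mono ?_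
  rintro s₃ ⟨L, k13, hL, hL', kx, km, kt⟩
  have low : ∀ x, x ≠ 12 → x ≠ 13 → x ≠ 14 → s₃.reg x = s₁.reg x := fun x h12 h13 h14 =>
    (kx x h13 h14).trans (gx x h12)
  have l12 : s₃.reg 12 = m := (kx 12 (by norm_num) (by norm_num)).trans g12
  have l15 : s₃.reg 15 = K := (low 15 (by norm_num) (by norm_num) (by norm_num)).trans f15
  have hLN : L ≤ N := by
    by_contra! h
    have h1 : 2 ^ (N + 1) ≤ 2 ^ L := Nat.pow_le_pow_right (by norm_num) h
    have h2 : N < 2 ^ N := Nat.lt_two_pow_self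
    rw [pow_succ] at h1
    omega
  have c1 : m ^ 2 ≤ (q + 1) ^ 2 := Nat.pow_le_pow_left hmk 2
  have c2 : m ^ 2 * L ≤ (q + 1) ^ 2 * N := Nat.mul_le_mul c1 hLN
  have c3 : m ^ 2 * L * K ≤ (q + 1) ^ 2 * N * K := Nat.mul_le_mul_right K c2
  have c4 : (q + 1) ^ 2 * N * (K + 1) = (q + 1) ^ 2 * N * K + (q + 1) ^ 2 * N := by ring
  have c5 : (q + 1) ^ 2 * 1 ≤ (q + 1) ^ 2 * N := Nat.mul_le_mul_left _ (by omega)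
  have k1 : m * m % 2 ^ w = m ^ 2 := by rw [← sq]; exact Nat.mod_eq_of_lt (by omega)
  have k2 : m ^ 2 * L % 2 ^ w = m ^ 2 * L := Nat.mod_eq_of_lt (by omega)
  have k3 : m ^ 2 * L * K % 2 ^ w = K * m ^ 2 * L := by
    rw [Nat.mod_eq_of_lt (by omega)]; ring
  simp only [↓ensures_block_cons, ↓ensures_arith, ↓ensures_block_nil]
  have hmem : s₃.mem = s.mem := km.trans (gm.trans fm)
  have ne : ∀ x, x ≠ 10 → x ≠ 12 → x ≠ 13 → x ≠ 14 → (Function.update (Function.update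
      (Function.update s₃.reg 10 (m ^ 2)) 10 (m ^ 2 * L)) 10 (K * m ^ 2 * L)) x = s₁.reg x :=
    fun x h10 h12 h13 h14 => by simp [h10, low x h12 h13 h14]
  simp only [State.tick, State.setReg, Op.eval, l12, k1, Function.update_self, ne_eq,
    Nat.reduceEqDiff, not_false_eq_true, Function.update_of_ne, k13, k2, l15, k3]
  refine ⟨m, L, hm1, hmk, hm2, hm3, hL, hL', ?_, hmem, ?_⟩
  · exact
      { reg0 := (ne 0 (by norm_num) (by norm_num) (by norm_num) (by norm_num)).trans f0
        reg1 := (ne 1 (by norm_num) (by norm_num) (by norm_num) (by norm_num)).trans f1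
        reg2 := (ne 2 (by norm_num) (by norm_num) (by norm_num) (by norm_num)).trans f2
        reg3 := (ne 3 (by norm_num) (by norm_num) (by norm_num) (by norm_num)).trans f3
        reg4 := (ne 4 (by norm_num) (by norm_num) (by norm_num) (by norm_num)).trans f4
        reg5 := (ne 5 (by norm_num) (by norm_num) (by norm_num) (by norm_num)).trans f5
        reg6 := (ne 6 (by norm_num) (by norm_num) (by norm_num) (by norm_num)).trans f6
        reg7 := (ne 7 (by norm_num) (by norm_num) (by norm_num) (by norm_num)).trans f7
        reg8 := (ne 8 (by norm_num) (by norm_num) (by norm_num) (by norm_num)).trans f8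
        reg9 := (ne 9 (by norm_num) (by norm_num) (by norm_num) (by norm_num)).trans f9
        reg10 := by simp
        reg11 := (ne 11 (by norm_num) (by norm_num) (by norm_num) (by norm_num)).trans f11
        reg16 := (ne 16 (by norm_num) (by norm_num) (by norm_num) (by norm_num)).trans f16
        memA := fun i hi k hk => by rw [hmem]; exact hA i hi k hk
        memB := fun j hj k hk => by rw [hmem]; exact hB j hj k hk }
  · have := Nat.mul_le_mul_left q hr
    omega

/-! ### Probability of failure and the time bound -/

theorem natDist_cast_sq (m n : ℕ) : ((Nat.dist m n : ℕ) : ℝ) ^ 2 = ((m : ℝ) - n) ^ 2 := by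
  rcases le_total m n with h | h
  · rw [Nat.dist_eq_sub_of_le h, Nat.cast_sub h]
    ring
  · rw [Nat.dist_eq_sub_of_le_right h, Nat.cast_sub h]

theorem distTo_cast {q : ℕ} {a σ : ℕ → ℕ} (ha : ∀ k < q, a k ≤ 1) (hσ : ∀ k < q, σ k ≤ 1) :
    (distTo q a σ : ℝ) = ∑ k ∈ Finset.range q, (σ k + (1 - 2 * (σ k : ℝ)) * a k) := by
  unfold distTo
  push_cast
  refine Finset.sum_congr rfl fun k hk => ?_
  have h1 := ha k (Finset.mem_range.1 hk)
  have h2 := hσ k (Finset.mem_range.1 hk)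
  interval_cases a k <;> interval_cases σ k <;> norm_num [Nat.dist]

section

variable {q : ℕ} {a b : ℕ → ℕ} (ha : ∀ k < q, a k ≤ 1) (hb : ∀ k < q, b k ≤ 1)
include ha hb

/-- The difference of the distances to a bit string is a signed sum of the differences. -/
theorem dist_distTo_sq {σ : ℕ → ℕ} (hσ : ∀ k < q, σ k ≤ 1) :
    ((Nat.dist (distTo q a σ) (distTo q b σ) ^ 2 : ℕ) : ℝ) =
      signedSum q σ (fun k => (a k : ℝ) - b k) ^ 2 := by
  rw [Nat.cast_pow, natDist_cast_sq, distTo_cast ha hσ, distTo_cast hb hσ,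
    ← Finset.sum_sub_distrib, signedSum]
  congr 1
  refine Finset.sum_congr rfl fun k _ => ?_
  ring

/-- For the complement of the second sequence, the difference of the distances becomes their sum
minus `q`. -/
theorem dist_distTo_add_sq {σ : ℕ → ℕ} (hσ : ∀ k < q, σ k ≤ 1) :
    ((Nat.dist (distTo q a σ + distTo q b σ) q ^ 2 : ℕ) : ℝ) =
      signedSum q σ (fun k => (a k : ℝ) + b k - 1) ^ 2 := by
  have hq : (q : ℝ) = ∑ k ∈ Finset.range q, (1 : ℝ) := by simp
  rw [Nat.cast_pow, natDist_cast_sq, Nat.cast_add, distTo_cast ha hσ, distTo_cast hb hσ]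
  rw [hq, ← Finset.sum_add_distrib, ← Finset.sum_sub_distrib, signedSum]
  congr 1
  refine Finset.sum_congr rfl fun k _ => ?_
  ring

theorem sum_sub_sq : ∑ k ∈ Finset.range q, ((a k : ℝ) - b k) ^ 2 = distTo q a b := by
  unfold distTo
  push_cast
  refine Finset.sum_congr rfl fun k hk => ?_
  have h1 := ha k (Finset.mem_range.1 hk)
  have h2 := hb k (Finset.mem_range.1 hk)
  interval_cases a k <;> interval_cases b k <;> norm_num [Nat.dist]

theorem sum_add_sub_one_sq :
    ∑ k ∈ Finset.range q, ((a k : ℝ) + b k - 1) ^ 2 = ((q - distTo q a b : ℕ) : ℝ) := by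
  have hq : (q : ℝ) = ∑ k ∈ Finset.range q, (1 : ℝ) := by simp
  rw [Nat.cast_sub (distTo_le ha hb), ← sum_sub_sq ha hb, hq, ← Finset.sum_sub_distrib]
  refine Finset.sum_congr (by simp) fun k hk => ?_
  have h1 := ha k (Finset.mem_range.1 hk)
  have h2 := hb k (Finset.mem_range.1 hk)
  interval_cases a k <;> interval_cases b k <;> norm_num

/-- The inner product of two 0-1 sequences is determined by their sums and their distance. -/
theorem two_mul_sum_mul_add_distTo :
    2 * ∑ k ∈ Finset.range q, a k * b k + distTo q a b =
      distTo q a (fun _ => 0) + distTo q b fun _ => 0 := by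
  unfold distTo
  rw [Finset.mul_sum, ← Finset.sum_add_distrib, ← Finset.sum_add_distrib]
  refine Finset.sum_congr rfl fun k hk => ?_
  have h1 := ha k (Finset.mem_range.1 hk)
  have h2 := hb k (Finset.mem_range.1 hk)
  interval_cases a k <;> interval_cases b k <;> norm_num [Nat.dist]

end

/-- The event that both accumulators of the pair with index `e` are close to their means. -/
def Accurate (q r T : ℕ) (a b : ℕ → ℕ → ℕ) (δ : ℝ) (e : ℕ) (ω : (ℕ → ℕ) × (ℕ → ℕ)) : Prop :=
  |(ω.1 e : ℝ) - T * distTo q (a (e / r)) (b (e % r))| ≤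
      δ * (T * distTo q (a (e / r)) (b (e % r))) ∧
  |(ω.2 e : ℝ) - T * (q - distTo q (a (e / r)) (b (e % r)) : ℕ)| ≤
      δ * (T * (q - distTo q (a (e / r)) (b (e % r)) : ℕ))

/-- After `T` rounds, all accumulators are accurate with high probability. -/
theorem expect_not_accurate_le {p q r T : ℕ} {a b : ℕ → ℕ → ℕ}
    (ha : ∀ i < p, ∀ k < q, a i k ≤ 1) (hb : ∀ j < r, ∀ k < q, b j k ≤ 1) {δ : ℝ} (hδ : 0 < δ)
    (hδ1 : δ ≤ 1) :
    expect (iterM (roundStep q (incDiff q r a b) (incSum q r a b)) T (fun _ => 0, fun _ => 0))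
        ({ω | ∀ e < p * r, Accurate q r T a b δ e ω}ᶜ.indicator 1) ≤
      (p * r : ℕ) * (4 * ENNReal.ofReal (Real.exp (-(T * δ ^ 2 / 32)))) := by
  set μ := iterM (roundStep q (incDiff q r a b) (incSum q r a b)) T (fun _ => 0, fun _ => 0)
  set E := ENNReal.ofReal (Real.exp (-(T * δ ^ 2 / 32)))
  let h (e : ℕ) : ℕ := distTo q (a (e / r)) (b (e % r))
  let bad₁ (e : ℕ) : Set ((ℕ → ℕ) × (ℕ → ℕ)) := {ω | δ * (T * h e) < |(ω.1 e : ℝ) - T * h e|}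
  let bad₂ (e : ℕ) : Set ((ℕ → ℕ) × (ℕ → ℕ)) :=
    {ω | δ * (T * (q - h e : ℕ)) < |(ω.2 e : ℝ) - T * (q - h e : ℕ)|}
  have key₁ : ∀ e < p * r, expect μ ((bad₁ e).indicator 1) ≤ 2 * E := by
    intro e he
    have hae := ha _ (div_lt_and_mod_lt he).1
    have hbe := hb _ (div_lt_and_mod_lt he).2
    refine expect_deviation_le (μ := μ) (Y := fun ω => ω.1 e) (h := h e) hδ hδ1 fun l hl => ?_
    refine expect_exp_rounds_le (Y := fun ω => ω.1 e) hl (sum_sub_sq hae hbe) rfl fun ω σ hσ => ?_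
    rw [Nat.cast_add, incDiff, dist_distTo_sq hae hbe hσ]
  have key₂ : ∀ e < p * r, expect μ ((bad₂ e).indicator 1) ≤ 2 * E := by
    intro e he
    have hae := ha _ (div_lt_and_mod_lt he).1
    have hbe := hb _ (div_lt_and_mod_lt he).2
    refine expect_deviation_le (μ := μ) (Y := fun ω => ω.2 e) (h := q - h e) hδ hδ1 fun l hl => ?_
    refine expect_exp_rounds_le (Y := fun ω => ω.2 e) hl (sum_add_sub_one_sq hae hbe) rfl
      fun ω σ hσ => ?_
    rw [Nat.cast_add, incSum, dist_distTo_add_sq hae hbe hσ]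
  calc _ ≤ expect μ fun ω => ∑ e ∈ Finset.range (p * r),
        ((bad₁ e).indicator 1 ω + (bad₂ e).indicator 1 ω) := by
        refine expect_mono fun ω => ?_
        by_cases hω : ∀ e < p * r, Accurate q r T a b δ e ω
        · rw [Set.indicator_of_notMem (by simpa using hω)]
          exact zero_le
        · refine (Set.indicator_le_self' (fun _ _ => zero_le) ω).trans ?_
          push Not at hω
          obtain ⟨e, he, hne⟩ := hω
          refine le_trans ?_ (Finset.single_le_sum (fun _ _ => zero_le) (Finset.mem_range.2 he))
          rw [Accurate, not_and_or, not_le, not_le] at hne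
          rcases hne with h1 | h1
          · rw [Set.indicator_of_mem (show ω ∈ bad₁ e from h1)]
            exact le_self_add
          · rw [Set.indicator_of_mem (show ω ∈ bad₂ e from h1)]
            exact le_add_self
    _ = ∑ e ∈ Finset.range (p * r), (expect μ ((bad₁ e).indicator 1) +
        expect μ ((bad₂ e).indicator 1)) := by
        rw [expect_finset_sum]
        exact Finset.sum_congr rfl fun e _ => expect_add _ _ _
    _ ≤ ∑ e ∈ Finset.range (p * r), 4 * E := by
        refine Finset.sum_le_sum fun e he => ?_
        rw [Finset.mem_range] at he
        refine (add_le_add (key₁ e he) (key₂ e he)).trans (le_of_eq ?_)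
        ring
    _ = _ := by simp

/-- The union bound over all pairs, for a sufficient number of rounds. -/
theorem failure_le {p q r T : ℕ} (hp : 1 ≤ p) (hq : 1 ≤ q) {δ α : ℝ}
    (hT : (α + 2) * Real.log (p * q + q * r : ℕ) ≤ T * δ ^ 2 / 32) :
    (p * r : ℕ) * (4 * ENNReal.ofReal (Real.exp (-(T * δ ^ 2 / 32)))) ≤
      ENNReal.ofReal (1 / ((p * q + q * r : ℕ) : ℝ) ^ α) := by
  set N := p * q + q * r with hN
  have hNpos : 0 < N := by have := Nat.mul_le_mul hp hq; omega
  have hNpos' : (0 : ℝ) < N := by exact_mod_cast hNpos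
  have h4 : 4 * (p * r) ≤ N ^ 2 := by
    have h1 : p + r ≤ N := by
      have := Nat.mul_le_mul_left (p + r) hq
      rw [hN]
      nlinarith
    have h2 := Nat.pow_le_pow_left h1 2
    have h3 : 4 * (p * r) ≤ (p + r) ^ 2 := by
      zify
      nlinarith [sq_nonneg ((p : ℤ) - r)]
    omega
  rw [show ((p * r : ℕ) : ℝ≥0∞) = ENNReal.ofReal (p * r : ℕ) by simp,
    show (4 : ℝ≥0∞) = ENNReal.ofReal 4 by simp, ← ENNReal.ofReal_mul (by norm_num),
    ← ENNReal.ofReal_mul (by positivity)]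
  refine ENNReal.ofReal_le_ofReal ?_
  have h5 : (4 * (p * r : ℕ) : ℝ) ≤ N ^ 2 := by exact_mod_cast h4
  calc ((p * r : ℕ) : ℝ) * (4 * Real.exp (-(T * δ ^ 2 / 32)))
      = 4 * (p * r : ℕ) * Real.exp (-(T * δ ^ 2 / 32)) := by ring
    _ ≤ N ^ 2 * Real.exp (-((α + 2) * Real.log N)) := by
        gcongr
    _ = 1 / (N : ℝ) ^ α := by
        have h6 : Real.exp (-((α + 2) * Real.log N)) = (N : ℝ) ^ (-(α + 2)) := by
          rw [Real.rpow_def_of_pos hNpos']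
          ring_nf
        rw [h6, one_div, ← Real.rpow_neg hNpos'.le, ← Real.rpow_natCast,
          ← Real.rpow_add hNpos']
        congr 1
        push_cast
        ring

theorem le_toOuterMeasure_bind {ρ : PMF State} {k : State → PMF State} {Q : State → Prop}
    {u : Set State} {x : ℝ≥0∞} (h : Ensures ρ Q) (h' : ∀ s, Q s → x ≤ (k s).toOuterMeasure u) :
    x ≤ (ρ.bind k).toOuterMeasure u := by
  rw [toOuterMeasure_eq_expect, expect_bind, ← expect_const ρ x]
  refine expect_mono_support fun s hs => ?_
  rw [← toOuterMeasure_eq_expect]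
  exact h' s (h s hs)

/-- A lower bound for the time that is granted. -/
theorem le_approxMatMulTime {p q r : ℕ} {ε : ℝ} (hp : 1 ≤ p) (hq : 2 ≤ q) (hε : 0 < ε)
    (hε2 : ε ≤ 1 / 2) :
    2 / 5 * (Real.log (p * q + q * r : ℕ) / ε ^ 2 * (p * q + q * r + p * r : ℕ)) ≤
      approxMatMulTime p q r ε := by
  have h1 : 5 * Real.log (3 / 2) ≤ 3 * Real.log 2 := by
    have : Real.log ((3 / 2 : ℝ) ^ 5) ≤ Real.log ((2 : ℝ) ^ 3) :=
      Real.log_le_log (by norm_num) (by norm_num)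
    rw [Real.log_pow, Real.log_pow] at this
    exact_mod_cast this
  have h2 : (5 / 3 : ℝ) ≤ Real.logb (1 + ε) q := by
    have h3 : 0 < Real.log (1 + ε) := Real.log_pos (by linarith)
    rw [Real.logb, le_div_iff₀ h3]
    have h4 : Real.log (1 + ε) ≤ Real.log (3 / 2) := Real.log_le_log (by linarith) (by linarith)
    have h5 : Real.log 2 ≤ Real.log q := Real.log_le_log (by norm_num) (by exact_mod_cast hq)
    linarith
  have h3 : (2 / 5 : ℝ) ≤ Real.log (Real.logb (1 + ε) q) := by
    have h4 := Real.one_sub_inv_le_log_of_pos (show (0 : ℝ) < 5 / 3 by norm_num)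
    have h5 := Real.log_le_log (by norm_num) h2
    norm_num at h4
    linarith
  have h6 : 0 ≤ Real.log (p * q + q * r : ℕ) / ε ^ 2 := by
    have : 0 ≤ Real.log (p * q + q * r : ℕ) := Real.log_natCast_nonneg _
    positivity
  unfold approxMatMulTime
  rw [mul_left_comm]
  refine mul_le_mul_of_nonneg_left ?_ h6
  have h7 : (0 : ℝ) ≤ (p * q + q * r : ℕ) := by positivity
  have h8 : (0 : ℝ) ≤ p * r := by positivity
  have h9 := mul_le_mul_of_nonneg_left h2 h7
  have h10 := mul_le_mul_of_nonneg_left h3 h8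
  rw [Nat.cast_add _ (p * r), Nat.cast_mul p r]
  linarith

/-! ### Matrices, constants, and the conclusion -/

/-- The rows of a matrix as sequences, extended by zero. -/
def natRows {p q : ℕ} (A : Matrix (Fin p) (Fin q) ℕ) (i k : ℕ) : ℕ :=
  if h : i < p ∧ k < q then A ⟨i, h.1⟩ ⟨k, h.2⟩ else 0

theorem natRows_val {p q : ℕ} (A : Matrix (Fin p) (Fin q) ℕ) (i : Fin p) (k : Fin q) :
    natRows A i k = A i k := by
  simp [natRows]

theorem natRows_le_one {p q : ℕ} {A : Matrix (Fin p) (Fin q) ℕ} (hA : ∀ i k, A i k = 0 ∨ A i k = 1) :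
    ∀ i < p, ∀ k < q, natRows A i k ≤ 1 := by
  intro i hi k hk
  rw [show natRows A i k = A ⟨i, hi⟩ ⟨k, hk⟩ from natRows_val A ⟨i, hi⟩ ⟨k, hk⟩]
  rcases hA ⟨i, hi⟩ ⟨k, hk⟩ with h | h <;> omega

theorem finProdFinEquiv_symm_mk {p q i k : ℕ} (hi : i < p) (hk : k < q) (h : i * q + k < p * q) :
    finProdFinEquiv.symm (⟨i * q + k, h⟩ : Fin (p * q)) = (⟨i, hi⟩, ⟨k, hk⟩) := by
  rw [Equiv.symm_apply_eq]
  ext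
  simp only [finProdFinEquiv_apply_val]
  ring

section MatrixInput

variable {p q r : ℕ} (A : Matrix (Fin p) (Fin q) ℕ) (B : Matrix (Fin q) (Fin r) ℕ)

theorem matrixInput_memA : ∀ i < p, ∀ k < q, (matrixInput A B).mem (i * q + k) = natRows A i k := by
  intro i hi k hk
  have h := add_mul_lt hi hk
  simp only [matrixInput, dif_pos h, finProdFinEquiv_symm_mk hi hk h]
  exact (natRows_val A ⟨i, hi⟩ ⟨k, hk⟩).symm

theorem matrixInput_memB : ∀ j < r, ∀ k < q,
    (matrixInput A B).mem (p * q + j + k * r) = natRows B.transpose j k := by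
  intro j hj k hk
  have h := add_mul_lt hk hj
  have e : p * q + j + k * r - p * q = k * r + j := by omega
  simp only [matrixInput, dif_neg (show ¬ p * q + j + k * r < p * q by omega), e, dif_pos h,
    finProdFinEquiv_symm_mk hk hj h]
  exact (natRows_val B.transpose ⟨j, hj⟩ ⟨k, hk⟩).symm

theorem matrixInput_mem_eq_zero {x : ℕ} (hx : p * q + q * r ≤ x) : (matrixInput A B).mem x = 0 := by
  simp only [matrixInput, dif_neg (show ¬ x < p * q by omega),
    dif_neg (show ¬ x - p * q < q * r by omega)]

theorem hammingDist_eq_distTo (hA : ∀ i k, A i k = 0 ∨ A i k = 1)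
    (hB : ∀ k j, B k j = 0 ∨ B k j = 1) (i : Fin p) (j : Fin r) :
    hammingDist (A i) (fun k => B k j) = distTo q (natRows A i) (natRows B.transpose j) := by
  rw [distTo, Finset.sum_range, hammingDist, Finset.card_filter]
  refine Finset.sum_congr rfl fun k _ => ?_
  rw [natRows_val, natRows_val, Matrix.transpose_apply]
  rcases hA i k with h | h <;> rcases hB k j with h' | h' <;> simp [h, h', Nat.dist]

theorem mul_apply_eq_sum_range (i : Fin p) (j : Fin r) :
    (A * B) i j = ∑ k ∈ Finset.range q, natRows A i k * natRows B.transpose j k := by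
  rw [Matrix.mul_apply, Finset.sum_range]
  refine Finset.sum_congr rfl fun k _ => ?_
  rw [natRows_val, natRows_val, Matrix.transpose_apply]

end MatrixInput

/-- An error of at most `x / m` is at most `ε * x` if `1 < ε * m`, and it vanishes if `x < m`. -/
theorem abs_sub_le_of_le_div {o C m q : ℕ} {ε x : ℝ} (hε : 0 < ε) (hm : 1 ≤ m) (hx : 0 ≤ x)
    (hxq : x ≤ q) (h : |(o : ℝ) - C| ≤ x / m) (hmε : 1 < ε * m ∨ m = q + 1) :
    |(o : ℝ) - C| ≤ ε * x := by
  have hm' : (0 : ℝ) < m := by exact_mod_cast hm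
  rcases hmε with h1 | rfl
  · refine h.trans ?_
    rw [div_le_iff₀ hm']
    nlinarith
  · have h2 : |(o : ℝ) - C| < 1 := by
      refine h.trans_lt ?_
      rw [div_lt_one hm']
      push_cast
      linarith
    have h3 : |(o : ℤ) - C| < 1 := by exact_mod_cast h2
    rw [Int.abs_lt_one_iff, sub_eq_zero] at h3
    have h4 : o = C := by exact_mod_cast h3
    rw [h4, sub_self, abs_zero]
    positivity

/-- Words that are long enough hold all numbers that occur. -/
theorem word_bounds {p q r K m L w : ℕ} (hp : 1 ≤ p) (hq : 1 ≤ q) (hr : 1 ≤ r)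
    (hm : m ≤ q + 1) (hL : 2 ^ L < 2 * (p * q + q * r))
    (hw : 16 * (K + 1) * (p * q + q * r) ^ 5 ≤ 2 ^ w) :
    2 * q * (K * m ^ 2 * L) + K * m ^ 2 * L * q ^ 2 + 2 * (K * m ^ 2 * L) < 2 ^ w ∧
    p * q + q * r + p * r + p * r + q + p + r < 2 ^ w ∧ 2 * (p * q + q * r) < 2 ^ w ∧
    (q + 1) ^ 2 * (p * q + q * r) * (K + 1) < 2 ^ w := by
  have hpN := Nat.mul_le_mul_left p hq
  have hrN := Nat.mul_le_mul_right r hq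
  have hqN := Nat.mul_le_mul_left q hr
  have hqN' := Nat.mul_le_mul_right q hp
  set N := p * q + q * r with hN
  have hN2 : 2 ≤ N := by omega
  have hLN : L ≤ N := by
    by_contra! h
    have h1 : 2 ^ (N + 1) ≤ 2 ^ L := Nat.pow_le_pow_right (by norm_num) h
    have h2 : N < 2 ^ N := Nat.lt_two_pow_self
    rw [pow_succ] at h1
    omega
  have hpr : p * r ≤ N ^ 2 := by
    rw [sq]
    exact Nat.mul_le_mul (by omega) (by omega)
  have hpow : ∀ a b, a ≤ b → N ^ a ≤ N ^ b := fun a b h => Nat.pow_le_pow_right (by omega) h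
  have hNN : 2 * N ≤ N ^ 2 := by
    rw [sq]
    exact Nat.mul_le_mul_right _ hN2
  have h25 := hpow 2 5 (by norm_num)
  have h35 := hpow 3 5 (by norm_num)
  have hN5 : 0 < N ^ 5 := by positivity
  have hK5 : 16 * (K + 1) * N ^ 5 = 16 * (K * N ^ 5) + 16 * N ^ 5 := by ring
  have hq1 : (q + 1) ^ 2 ≤ 4 * N ^ 2 := by
    calc (q + 1) ^ 2 ≤ (2 * N) ^ 2 := Nat.pow_le_pow_left (by omega) 2
      _ = 4 * N ^ 2 := by ring
  have hT : K * m ^ 2 * L ≤ 4 * (K * N ^ 3) := by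
    calc K * m ^ 2 * L ≤ K * (4 * N ^ 2) * N := by
          refine Nat.mul_le_mul (Nat.mul_le_mul_left _ ?_) hLN
          exact (Nat.pow_le_pow_left hm 2).trans hq1
      _ = 4 * (K * N ^ 3) := by ring
  refine ⟨?_, ?_, ?_, ?_⟩
  · calc 2 * q * (K * m ^ 2 * L) + K * m ^ 2 * L * q ^ 2 + 2 * (K * m ^ 2 * L)
        = K * m ^ 2 * L * (2 * q + q ^ 2 + 2) := by ring
      _ ≤ 4 * (K * N ^ 3) * (4 * N ^ 2) := by
          refine Nat.mul_le_mul hT ?_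
          have : q ^ 2 ≤ N ^ 2 := Nat.pow_le_pow_left (by omega) 2
          omega
      _ = 16 * (K * N ^ 5) := by ring
      _ < 2 ^ w := by omega
  · omega
  · omega
  · calc (q + 1) ^ 2 * N * (K + 1) ≤ 4 * N ^ 2 * N * (K + 1) := by gcongr
      _ = 4 * (K + 1) * N ^ 3 := by ring
      _ ≤ 4 * (K + 1) * N ^ 5 := Nat.mul_le_mul_left _ h35
      _ < 2 ^ w := by
          have : 4 * (K + 1) * N ^ 5 = 4 * (K * N ^ 5) + 4 * N ^ 5 := by ring
          omega

/-- A word length that meets the hypothesis of `word_bounds`; the constant factor is absorbed because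
the logarithm is positive. -/
theorem le_two_pow_mul_clog {K N : ℕ} (hN : 2 ≤ N) :
    16 * (K + 1) * N ^ 5 ≤ 2 ^ ((16 * (K + 1) + 5) * Nat.clog 2 N) := by
  have h1 : N ≤ 2 ^ Nat.clog 2 N := Nat.le_pow_clog (by norm_num) N
  have h2 : 1 ≤ Nat.clog 2 N := Nat.clog_pos (by norm_num) hN
  calc 16 * (K + 1) * N ^ 5
      ≤ 2 ^ (16 * (K + 1) * Nat.clog 2 N) * (2 ^ Nat.clog 2 N) ^ 5 := by
        refine Nat.mul_le_mul ?_ (Nat.pow_le_pow_left h1 5)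
        exact Nat.lt_two_pow_self.le.trans
          (Nat.pow_le_pow_right (by norm_num) (Nat.le_mul_of_pos_right _ h2))
    _ = _ := by rw [← pow_mul, ← pow_add]; ring_nf

/-- The number of rounds suffices for the relative accuracy `1 / (3 m)`: the factor `m ^ 2` cancels,
and `288 = 32 * 3 ^ 2`. -/
theorem rounds_sufficient {N K m L : ℕ} {α : ℝ} (hm : 1 ≤ m)
    (hL : N ≤ 2 ^ L) (hN : 2 ≤ N) (hK : 288 * (α + 2) ≤ K) :
    (α + 2) * Real.log N ≤ (K * m ^ 2 * L : ℕ) * (1 / (3 * (m : ℝ))) ^ 2 / 32 := by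
  have hm' : (0 : ℝ) < m := by exact_mod_cast hm
  have h1 : Real.log N ≤ L := by
    have h2 : Real.log N ≤ Real.log ((2 : ℝ) ^ L) :=
      Real.log_le_log (by positivity) (by exact_mod_cast hL)
    rw [Real.log_pow] at h2
    have h3 : Real.log 2 ≤ 1 := by linarith [Real.log_two_lt_d9]
    nlinarith [show (0 : ℝ) ≤ L by positivity]
  have h2 : ((K * m ^ 2 * L : ℕ) : ℝ) * (1 / (3 * (m : ℝ))) ^ 2 / 32 = K / 288 * L := by
    push_cast
    field_simp
    ring
  rw [h2]
  have h3 : 0 ≤ Real.log N := Real.log_natCast_nonneg _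
  exact mul_le_mul (by linarith) h1 h3 (by positivity)

/-- The number of rounds is `O(log N / ε ^ 2)`, since `m ≤ 2 / ε` and `L ≤ 4 log N` for the capped
`ε`. -/
theorem rounds_le {N K m L : ℕ} {ε : ℝ} (hε : 0 < ε) (hm : 1 ≤ m)
    (hmε : m = 1 ∨ ε * (m - 1) ≤ 1) (hL : 2 ^ L < 2 * N) (hN : 2 ≤ N) :
    ((K * m ^ 2 * L : ℕ) : ℝ) ≤ 16 * K * (Real.log N / min ε (1 / 2) ^ 2) := by
  set η := min ε (1 / 2)
  have hη : 0 < η := lt_min hε (by norm_num)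
  have hη1 : η ≤ ε := min_le_left _ _
  have hη2 : η ≤ 1 / 2 := min_le_right _ _
  have hm' : (1 : ℝ) ≤ m := by exact_mod_cast hm
  have h1 : η * m ≤ 2 := by
    rcases hmε with rfl | h
    · push_cast
      linarith
    · have : η * (m - 1) ≤ ε * (m - 1) := mul_le_mul_of_nonneg_right hη1 (by linarith)
      linarith
  have h2 : (m : ℝ) ^ 2 ≤ 4 / η ^ 2 := by
    rw [le_div_iff₀ (by positivity)]
    nlinarith [show (0 : ℝ) ≤ η * m by positivity]
  have h3 : (L : ℝ) ≤ 4 * Real.log N := by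
    have hN' : (2 : ℝ) ≤ N := by exact_mod_cast hN
    have h4 : Real.log ((2 : ℝ) ^ L) ≤ Real.log (2 * N) :=
      Real.log_le_log (by positivity) (by exact_mod_cast hL.le)
    rw [Real.log_pow, Real.log_mul (by norm_num) (by linarith)] at h4
    have h5 : Real.log 2 ≤ Real.log N := Real.log_le_log (by norm_num) hN'
    have h6 : 1 / 2 ≤ Real.log 2 := by linarith [Real.log_two_gt_d9]
    nlinarith [show (0 : ℝ) ≤ L by positivity]
  have h4 : 0 ≤ Real.log N := Real.log_natCast_nonneg _
  calc ((K * m ^ 2 * L : ℕ) : ℝ) = K * (m ^ 2 * L) := by push_cast; ring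
    _ ≤ K * (4 / η ^ 2 * (4 * Real.log N)) := by gcongr
    _ = _ := by ring

/-- The total time is dominated by the rounds. Replacing `q` by `max q 2` only increases the bound. -/
theorem approx_time_bound {p q r K m L t : ℕ} {ε : ℝ} (hp : 1 ≤ p) (hq : 1 ≤ q) (hr : 1 ≤ r)
    (hK : 1 ≤ K) (hε : 0 < ε) (hm : 1 ≤ m) (hmε : m = 1 ∨ ε * (m - 1) ≤ 1)
    (hL : p * q + q * r ≤ 2 ^ L) (hL' : 2 ^ L < 2 * (p * q + q * r))
    (ht : t ≤ 12 * (p * q + q * r) + 30 +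
      (K * m ^ 2 * L + 2) * (100 * (p * q + q * r + p * r))) :
    (t : ℝ) ≤ 16000 * K * approxMatMulTime p (max q 2) r (min ε (1 / 2)) := by
  have hpq := Nat.mul_le_mul hp hq
  have hqr := Nat.mul_le_mul hq hr
  have hN : 2 ≤ p * q + q * r := by omega
  have hLpos : 1 ≤ L := by
    by_contra! h
    have : L = 0 := by omega
    subst this
    omega
  have hη : 0 < min ε (1 / 2) := lt_min hε (by norm_num)
  have hT := rounds_le (K := K) hε hm hmε hL' hN
  have hlow := le_approxMatMulTime (r := r) hp (le_max_right q 2) hη (min_le_right _ _)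
  set T := K * m ^ 2 * L with hTdef
  set M := p * q + q * r + p * r with hM
  set N := p * q + q * r with hNdef
  have hTpos : 1 ≤ T := Nat.mul_pos (Nat.mul_pos hK (by positivity)) hLpos
  have h1 : t ≤ 400 * (T * M) := by
    have h2 : M ≤ T * M := Nat.le_mul_of_pos_left _ hTpos
    have h3 : (T + 2) * (100 * M) = 100 * (T * M) + 200 * M := by ring
    omega
  have hN' : N ≤ p * max q 2 + max q 2 * r := by
    rw [hNdef]
    gcongr <;> exact le_max_left _ _
  have hlog : Real.log N ≤ Real.log (p * max q 2 + max q 2 * r : ℕ) :=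
    Real.log_le_log (by positivity) (by exact_mod_cast hN')
  have hlog0 : 0 ≤ Real.log N := Real.log_natCast_nonneg _
  have hM' : (M : ℝ) ≤ (p * max q 2 + max q 2 * r + p * r : ℕ) := by
    exact_mod_cast Nat.add_le_add_right hN' _
  calc (t : ℝ) ≤ 400 * (T * M) := by exact_mod_cast h1
    _ ≤ 400 * (16 * K * (Real.log (p * max q 2 + max q 2 * r : ℕ) / min ε (1 / 2) ^ 2) *
        (p * max q 2 + max q 2 * r + p * r : ℕ)) := by
        gcongr
        exact hT.trans (by gcongr)
    _ = 16000 * K * (2 / 5 * (Real.log (p * max q 2 + max q 2 * r : ℕ) / min ε (1 / 2) ^ 2 *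
        (p * max q 2 + max q 2 * r + p * r : ℕ))) := by ring
    _ ≤ _ := by gcongr

end WordRAM

open WordRAM in
theorem mainTheorem4 (α : ℝ) (hα : 1 ≤ α) :
    ∃ (prog : WordRAM.Prog) (c : ℕ) (K : ℝ),
      ∀ (p q r : ℕ) (_ : 1 ≤ p) (_ : 1 ≤ q) (_ : 1 ≤ r) (ε : ℝ) (_ : 0 < ε)
        (A : Matrix (Fin p) (Fin q) ℕ) (B : Matrix (Fin q) (Fin r) ℕ)
        (_ : ∀ i k, A i k = 0 ∨ A i k = 1) (_ : ∀ k j, B k j = 0 ∨ B k j = 1),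
        (∀ s ∈ (prog.run (c * Nat.clog 2 (p * q + q * r)) ε
              (WordRAM.matrixInput A B)).support,
            (s.time : ℝ) ≤ K * approxMatMulTime p (max q 2) r (min ε (1 / 2))) ∧
        ENNReal.ofReal (1 - 1 / ((p * q + q * r : ℕ) : ℝ) ^ α) ≤
          (prog.run (c * Nat.clog 2 (p * q + q * r)) ε
              (WordRAM.matrixInput A B)).toOuterMeasure
            {s | ∀ (i : Fin p) (j : Fin r),
              |(WordRAM.matrixOutput p q r s i j : ℝ) - ((A * B) i j : ℝ)| ≤
                ε * min (hammingDist (A i) (fun k => B k j) : ℝ)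
                  ((q : ℝ) - hammingDist (A i) (fun k => B k j))} := by
  -- `k₀` is the constant factor in the number of rounds
  obtain ⟨k₀, hk₀⟩ := exists_nat_ge (288 * (α + 2))
  refine ⟨(prologue k₀).seq mainProg, 16 * (k₀ + 1) + 5, 16000 * k₀, ?_⟩
  intro p q r hp hq hr ε hε A B hA hB
  have hk₀1 : 1 ≤ k₀ := by
    have : (0 : ℝ) < k₀ := by linarith
    exact_mod_cast this
  have hN : 2 ≤ p * q + q * r := by
    have h1 := Nat.mul_le_mul hp hq
    have h2 := Nat.mul_le_mul hq hr
    omega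
  have hw := le_two_pow_mul_clog (K := k₀) hN
  set w := (16 * (k₀ + 1) + 5) * Nat.clog 2 (p * q + q * r)
  set a := natRows A
  set b := natRows B.transpose
  have ha : ∀ i < p, ∀ k < q, a i k ≤ 1 := natRows_le_one hA
  have hb : ∀ j < r, ∀ k < q, b j k ≤ 1 := natRows_le_one fun j k => hB k j
  -- the last three bounds do not depend on `m` and `L`
  obtain ⟨-, hw₁, hw₂, hw₃⟩ := word_bounds (m := 0) (L := 0) hp hq hr (by omega) (by omega) hw
  have hpro := prologue_spec (ε := ε) hp hq hr (s := matrixInput A B) rfl rfl rfl rfl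
    (matrixInput_memA A B) (matrixInput_memB A B) hw₁ hw₂ hw₃
  have hrun : ((prologue k₀).seq mainProg).run w ε (matrixInput A B) =
      ((prologue k₀).run w ε (matrixInput A B)).bind (mainProg.run w ε) := rfl
  refine ⟨?_, ?_⟩
  · suffices h : Ensures (((prologue k₀).seq mainProg).run w ε (matrixInput A B)) fun s =>
        (s.time : ℝ) ≤ 16000 * k₀ * approxMatMulTime p (max q 2) r (min ε (1 / 2)) from h
    rw [ensures_seq]
    refine hpro.mono ?_
    rintro s ⟨m, L, hm1, hmq, hmε, hmε', hL, hL', hlay, hmem, htime⟩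
    have hT := (word_bounds hp hq hr hmq hL' hw).1
    refine (sim_mainProg hp hq hr ha hb hw₁ hT hlay fun e he => ?_).ensures.mono ?_
    · rw [hmem]
      exact matrixInput_mem_eq_zero A B he
    · rintro t ⟨ω, -, ht⟩
      refine approx_time_bound hp hq hr hk₀1 hε hm1 hmε' hL hL' (ht.trans ?_)
      have : (matrixInput A B).time = 0 := rfl
      omega
  · rw [hrun]
    refine le_toOuterMeasure_bind hpro ?_
    -- the number of rounds depends on the outcome of the preparation, so argue for each outcome
    rintro s ⟨m, L, hm1, hmq, hmε, hmε', hL, hL', hlay, hmem, htime⟩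
    have hT := (word_bounds hp hq hr hmq hL' hw).1
    have hm1' : (1 : ℝ) ≤ m := by exact_mod_cast hm1
    have hTpos : 0 < k₀ * m ^ 2 * L := by
      have : 0 < L := Nat.pos_of_ne_zero fun h => by
        rw [h] at hL
        omega
      positivity
    have hsim := sim_mainProg (ε := ε) hp hq hr ha hb hw₁ hT hlay fun e he => by
      rw [hmem]
      exact matrixInput_mem_eq_zero A B he
    set T := k₀ * m ^ 2 * L
    have hδ : 0 < 1 / (3 * (m : ℝ)) := by positivity
    have hδ1 : 1 / (3 * (m : ℝ)) ≤ 1 := by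
      rw [div_le_one (by positivity)]
      linarith
    refine le_trans ?_ (hsim.le_toOuterMeasure
      (t := {ω | ∀ e < p * r, Accurate q r T a b (1 / (3 * (m : ℝ))) e ω}) ?_)
    · rw [toOuterMeasure_eq_expect]
      have h1 := (expect_not_accurate_le (T := T) ha hb hδ hδ1).trans
        (failure_le hp hq (rounds_sufficient hm1 hL hN hk₀))
      rw [ENNReal.ofReal_sub _ (by positivity), ENNReal.ofReal_one, tsub_le_iff_right]
      rw [← expect_indicator_compl _ {ω | ∀ e < p * r, Accurate q r T a b (1 / (3 * (m : ℝ))) e ω}]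
      gcongr
    · rintro ω t ⟨hout, -⟩ hω i j
      have he := add_mul_lt i.isLt j.isLt
      have c1 : ((i : ℕ) * r + j) / r = i := by
        rw [mul_comm, Nat.mul_add_div (by omega), Nat.div_eq_of_lt j.isLt, add_zero]
      have c2 : ((i : ℕ) * r + j) % r = j := by
        rw [mul_comm, Nat.mul_add_mod, Nat.mod_eq_of_lt j.isLt]
      obtain ⟨h1, h2⟩ := hω _ he
      have h3 := hout _ he
      rw [c1, c2] at h1 h2 h3
      have hai := ha i i.isLt
      have hbj := hb j j.isLt
      have hdq := distTo_le hai hbj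
      have hdq' : (distTo q (a i) (b j) : ℝ) ≤ q := by exact_mod_cast hdq
      rw [matrixOutput, h3, mul_apply_eq_sum_range, hammingDist_eq_distTo A B hA hB]
      refine abs_sub_le_of_le_div hε hm1 (le_min (by positivity) (by linarith))
        ((min_le_left _ _).trans hdq') ?_ hmε
      exact abs_estimate_sub_le hTpos hm1' hdq (two_mul_sum_mul_add_distTo hai hbj) h1 h2
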